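/- Let $\mathrm{M}$ be a loopless matroid on a finite ground set, of rank at most $6$, and let $\mathcal{G}_{\max}$ be its maximal building set, that is, the set of all nonempty flats of $\mathrm{M}$. Let $$\operatorname{CH}(\mathrm{M},\mathcal{G}_{\max}) = \mathbb{Z}[x_F : F \in \mathcal{G}_{\max}]/I$$ be the Feichtner–Yuzvinsky Chow ring, where the ideal $I$ is generated by the monomials $x_{F_1}\cdots x_{F_k}$ for which $\{F_1,\ldots,F_k\}\subseteq\mathcal{G}_{\max}$ is not a nested set, and by the linear forms $\sum_{F \in \mathcal{G}_{\max},\, F\supseteq A} x_F$, one for each flat $A$ of rank $1$. Here a set $\mathcal{S}\subseteq\mathcal{G}_{\max}$ is nested if no antichain of at least two elements of $\mathcal{S}$ has its join (in the lattice of flats) in $\mathcal{G}_{\max}$; equivalently, if it is a chain. Grade the ring by $\deg x_F = 1$. Then its Hilbert–Poincaré series $$\mathrm{H}(\mathrm{M},\mathcal{G}_{\max})(t)=\sum_{k\geqslant 0}\operatorname{rank}_{\mathbb{Z}}\operatorname{CH}^k(\mathrm{M},\mathcal{G}_{\max})\,t^k$$ is a polynomial (the Chow polynomial of $(\mathrm{M},\mathcal{G}_{\max})$),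 and this polynomial is real-rooted, i.e. all its complex zeros are real. -/

import Mathlib

open scoped Polynomial PowerSeries

noncomputable section

namespace BuiltMatroid

variable {α : Type*}

/-- The maximal building set of the lattice of flats of `M`: all flats except the least one,
which is `M.closure ∅` (and is the empty set when `M` is loopless). -/
def maxBuildingSet (M : Matroid α) : Set (Set α) :=
  {F | M.IsFlat F ∧ F ≠ M.closure ∅}

/-- A subset `S` of a family `𝒢` of flats is nested if no antichain in `S` with at least two
elements has its join (the closure of its union) in `𝒢`. -/
def IsNested (M : Matroid α) (𝒢 S : Set (Set α)) : Prop :=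
  S ⊆ 𝒢 ∧ ∀ A ⊆ S, A.Nontrivial → IsAntichain (· ⊆ ·) A → M.closure (⋃₀ A) ∉ 𝒢

/-- The monomials `x_{F₁} ⋯ x_{F_k}` for which `{F₁, …, F_k} ⊆ 𝒢` is not nested. -/
def nonNestedMonomials (M : Matroid α) (𝒢 : Set (Set α)) : Set (MvPolynomial 𝒢 ℤ) :=
  {p | ∃ S : Finset 𝒢, ¬ IsNested M 𝒢 (Subtype.val '' (S : Set 𝒢)) ∧
    p = ∏ G ∈ S, MvPolynomial.X G}

/-- The linear forms `∑_{G ∈ 𝒢, G ⊇ A} x_G`, one for each atom (flat of rank one) `A`. The sum is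
finite when the ground set of `M` is finite and `𝒢` consists of flats. -/
def atomForms (M : Matroid α) (𝒢 : Set (Set α)) : Set (MvPolynomial 𝒢 ℤ) :=
  {p | ∃ A : Set α, M.IsFlat A ∧ M.eRk A = 1 ∧
    p = ∑ᶠ (G : 𝒢) (_ : A ⊆ (G : Set α)), MvPolynomial.X G}

/-- The ideal of relations of the Feichtner–Yuzvinsky Chow ring. -/
def chowIdeal (M : Matroid α) (𝒢 : Set (Set α)) : Ideal (MvPolynomial 𝒢 ℤ) :=
  Ideal.span (nonNestedMonomials M 𝒢 ∪ atomForms M 𝒢)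

/-- The Feichtner–Yuzvinsky Chow ring `CH(M, 𝒢)`. -/
abbrev ChowRing (M : Matroid α) (𝒢 : Set (Set α)) : Type _ :=
  MvPolynomial 𝒢 ℤ ⧸ chowIdeal M 𝒢

/-- The degree `k` piece `CH^k(M, 𝒢)`: the classes of homogeneous polynomials of degree `k`. -/
def chowPiece (M : Matroid α) (𝒢 : Set (Set α)) (k : ℕ) : Submodule ℤ (ChowRing M 𝒢) :=
  (MvPolynomial.homogeneousSubmodule 𝒢 ℤ k).map
    (Ideal.Quotient.mkₐ ℤ (chowIdeal M 𝒢)).toLinearMap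

/-- The Hilbert–Poincaré series `∑ₖ rank_ℤ CH^k(M, 𝒢) tᵏ` of the Chow ring. -/
def chowSeries (M : Matroid α) (𝒢 : Set (Set α)) : ℤ⟦X⟧ :=
  PowerSeries.mk fun k => (Module.finrank ℤ (chowPiece M 𝒢 k) : ℤ)

/-- A polynomial is real-rooted if all its complex roots are real. -/
def RealRooted (p : ℤ[X]) : Prop :=
  ∀ z : ℂ, Polynomial.aeval z p = 0 → z.im = 0

end BuiltMatroid

end

namespace BuiltMatroid

open scoped Classical

set_option linter.unusedSectionVars false

/-! Let r be the rank of the matroid. In the lattice of flats, replace the generators x_F by h_F =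
∑_{G ≥ F} x_G. These satisfy (h_F - h_{F∨G})(h_G - h_{F∨G}) = 0, and h_A = 0 for atoms A. The
monomials h_{F_1}^{a_1} ⋯ h_{F_k}^{a_k} over chains ⊥ = F_0 < F_1 < ⋯ < F_k with 1 ≤ a_i < rk F_i -
rk F_{i-1} form a ℤ-basis of the Chow ring, so the Hilbert–Poincaré series is their generating
polynomial `basisGen`.

Spanning (`upMon_mem_span`) is a straightening: the square relation trades an incomparable pair for
larger flats, and h_F h_G^d = h_G^{d+1} with d = rk G - rk F removes forbidden exponents; each move
lowers the total corank. For independence (`linearIndependent_upMon`), each basis monomial m has a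
test element τ with mτ = ±h_⊤^{r-1} (`exists_test`). Among monomials of the same degree, τ kills all
but those with at least as many factors as m below each flat of m, so τ isolates the monomial of
largest total corank in a linear relation.

That h_⊤^{r-1} is not torsion is seen from a functional on polynomials in the h_F: it is 1 on
monomials satisfying the dragon Hall–Rado condition and 0 on the others, and by submodularity of the
rank it vanishes on the ideal of relations (`degreeMap_mul_relation`). Möbius inversion turns the
quotient by that ideal into a realization of the original relations.

Counting basis monomials gives, for 1 ≤ r ≤ 6, a palindromic polynomial of degree r - 1. Apart from
a factor 1 + t in even rank, at most a quadratic or a quartic 1 + at + bt² + at³ + t⁴ is left. The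
quartic splits into two palindromic real-rooted quadratics when a ≥ 4, 2a ≤ b + 2 and 4b ≤ a² + 8.
With W_i the number of flats of rank i and W_{i,j} the number of flags of ranks i < j, these
conditions follow from 2W_i ≤ W_{i,j}, 2W_j ≤ W_{i,j} and W_{i,j} ≤ W_i W_j for 0 < i < j < r. -/

/-- `rk` is the rank function of a geometric lattice. -/
structure IsGeometricRank {L : Type*} [Lattice L] [BoundedOrder L] (rk : L → ℕ) : Prop where
  bot : rk ⊥ = 0
  strictMono : StrictMono rk
  submod : ∀ F G, rk (F ⊔ G) + rk (F ⊓ G) ≤ rk F + rk G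
  exists_atom : ∀ F G, F < G → ∃ A, rk A = 1 ∧ A ≤ G ∧ ¬ A ≤ F

/-- The defining relations of the Chow ring of a geometric lattice with respect to its maximal
building set. -/
structure FlatRelations {L R : Type*} [Lattice L] [Fintype L] [CommRing R] (rk : L → ℕ)
    (x : L → R) : Prop where
  mul_eq_zero : ∀ F G, ¬ F ≤ G → ¬ G ≤ F → x F * x G = 0
  atom_sum : ∀ A, rk A = 1 → ∑ G with A ≤ G, x G = 0

/-- The simplicial generators `h_F = ∑_{G ≥ F} x_G`. -/
noncomputable def upSum {L R : Type*} [Lattice L] [Fintype L] [CommRing R] (x : L → R) (F : L) : R :=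
  ∑ G with F ≤ G, x G

/-- The monomial `∏_{G ∈ S} h_G`. -/
noncomputable def upMon {L R : Type*} [Lattice L] [Fintype L] [CommRing R] (x : L → R)
    (S : Multiset L) : R :=
  (S.map (upSum x)).prod

/-- The total corank of a multiset of flats. -/
def corankSum {L : Type*} [Lattice L] [BoundedOrder L] (rk : L → ℕ) (S : Multiset L) : ℕ :=
  (S.map fun G => rk ⊤ - rk G).sum

/-! ### Total corank, the measure that decreases under straightening. -/

section CorankSum

variable {L : Type*} [Lattice L] [BoundedOrder L] {rk : L → ℕ}

@[simp] lemma corankSum_zero : corankSum rk (0 : Multiset L) = 0 := by simp [corankSum]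

@[simp] lemma corankSum_cons (G : L) (S : Multiset L) :
    corankSum rk (G ::ₘ S) = (rk ⊤ - rk G) + corankSum rk S := by simp [corankSum]

@[simp] lemma corankSum_add (S T : Multiset L) :
    corankSum rk (S + T) = corankSum rk S + corankSum rk T := by simp [corankSum]

@[simp] lemma corankSum_replicate (n : ℕ) (G : L) :
    corankSum rk (Multiset.replicate n G) = n * (rk ⊤ - rk G) := by
  simp [corankSum]

end CorankSum

/-! ### Covers and intervals in a geometric lattice. -/

namespace IsGeometricRank

variable {L : Type*} [Lattice L] [BoundedOrder L] {rk : L → ℕ}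

lemma le_top (hrk : IsGeometricRank rk) (F : L) : rk F ≤ rk ⊤ :=
  hrk.strictMono.monotone _root_.le_top

lemma eq_of_le (hrk : IsGeometricRank rk) {F G : L} (h : F ≤ G) (h' : rk G ≤ rk F) : F = G := by
  by_contra hne
  exact absurd (hrk.strictMono (lt_of_le_of_ne h hne)) (by omega)

lemma sup_atom (hrk : IsGeometricRank rk) {F A : L} (hA : rk A = 1) (h : ¬ A ≤ F) :
    rk (F ⊔ A) = rk F + 1 := by
  have h1 := hrk.submod F A
  have h2 : rk F < rk (F ⊔ A) :=
    hrk.strictMono (lt_of_le_of_ne le_sup_left fun e => h (e ▸ le_sup_right))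
  omega

lemma exists_cover_above (hrk : IsGeometricRank rk) {F G : L} (h : F < G) :
    ∃ F', F < F' ∧ F' ≤ G ∧ rk F' = rk F + 1 := by
  obtain ⟨A, hA, hAG, hAF⟩ := hrk.exists_atom F G h
  exact ⟨F ⊔ A, lt_of_le_of_ne le_sup_left fun e => hAF (e ▸ le_sup_right),
    sup_le h.le hAG, hrk.sup_atom hA hAF⟩

lemma exists_rank_eq (hrk : IsGeometricRank rk) {F G : L} (h : F ≤ G) {j : ℕ} (hj : rk F ≤ j)
    (hj' : j ≤ rk G) : ∃ K, F ≤ K ∧ K ≤ G ∧ rk K = j := by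
  induction j, hj using Nat.le_induction with
  | base => exact ⟨F, le_rfl, h, rfl⟩
  | succ j hj ih =>
    obtain ⟨K, h1, h2, h3⟩ := ih (by omega)
    have hlt : K < G := lt_of_le_of_ne h2 fun e => by subst e; omega
    obtain ⟨K', h4, h5, h6⟩ := hrk.exists_cover_above hlt
    exact ⟨K', h1.trans h4.le, h5, by omega⟩

lemma exists_cover_below (hrk : IsGeometricRank rk) {F G : L} (h : F < G) :
    ∃ K, F ≤ K ∧ K < G ∧ rk K + 1 = rk G := by
  have := hrk.strictMono h
  obtain ⟨K, h1, h2, h3⟩ := hrk.exists_rank_eq h.le (j := rk G - 1) (by omega) (by omega)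
  exact ⟨K, h1, lt_of_le_of_ne h2 fun e => by subst e; omega, by omega⟩

/-- An element between `F` and `T` with at least one element of its rank that differs from it. -/
lemma exists_two (hrk : IsGeometricRank rk) {F T : L} (h : F ≤ T) {j : ℕ} (hj : rk F < j)
    (hj' : j < rk T) : ∃ K K', K ≠ K' ∧ (F ≤ K ∧ K ≤ T ∧ rk K = j) ∧
      (F ≤ K' ∧ K' ≤ T ∧ rk K' = j) := by
  obtain ⟨K, h1, h2, h3⟩ := hrk.exists_rank_eq h hj.le hj'.le
  have hFK : F < K := lt_of_le_of_ne h1 fun e => by subst e; omega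
  have hKT : K < T := lt_of_le_of_ne h2 fun e => by subst e; omega
  -- Exchange: step down from K to a coatom of [F, K], then up again by an atom below T but not
  -- below K.
  obtain ⟨K', h4, h5, h6⟩ := hrk.exists_cover_below hFK
  obtain ⟨A, hA, hAT, hAK⟩ := hrk.exists_atom K T hKT
  have hAK' : ¬ A ≤ K' := fun e => hAK (e.trans h5.le)
  refine ⟨K, K' ⊔ A, fun e => hAK (e ▸ le_sup_right), ⟨h1, h2, h3⟩,
    h4.trans le_sup_left, sup_le (h5.le.trans h2) hAT, ?_⟩
  rw [hrk.sup_atom hA hAK']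
  omega

end IsGeometricRank

/-! ### Consequences of the relations for the simplicial generators. -/

section Relations

variable {L R : Type*} [Lattice L] [Fintype L] [CommRing R] {rk : L → ℕ} {x : L → R}

@[simp] lemma upMon_zero : upMon x 0 = 1 := by simp [upMon]

@[simp] lemma upMon_cons (G : L) (S : Multiset L) :
    upMon x (G ::ₘ S) = upSum x G * upMon x S := by simp [upMon]

@[simp] lemma upMon_add (S T : Multiset L) : upMon x (S + T) = upMon x S * upMon x T := by
  simp [upMon]

@[simp] lemma upMon_replicate (n : ℕ) (G : L) :
    upMon x (Multiset.replicate n G) = upSum x G ^ n := by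
  simp [upMon]

namespace FlatRelations

lemma atom (hx : FlatRelations rk x) {A : L} (hA : rk A = 1) : upSum x A = 0 := hx.atom_sum A hA

lemma upSum_sub (F G : L) : upSum x F - upSum x (F ⊔ G) = ∑ H with F ≤ H ∧ ¬ G ≤ H, x H := by
  rw [sub_eq_iff_eq_add, upSum, upSum, ← Finset.sum_filter_add_sum_filter_not _ (fun H => G ≤ H),
    Finset.filter_filter, Finset.filter_filter, add_comm]
  simp only [sup_le_iff]

/-- The two differences are sums of x_H over H ≥ F, H ≱ G and of x_K over K ≥ G, K ≱ F. Every such H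
and K are incomparable. -/
lemma square (hx : FlatRelations rk x) (F G : L) :
    (upSum x F - upSum x (F ⊔ G)) * (upSum x G - upSum x (F ⊔ G)) = 0 := by
  rw [upSum_sub, sup_comm, upSum_sub, Finset.sum_mul_sum]
  refine Finset.sum_eq_zero fun H hH => Finset.sum_eq_zero fun K hK => ?_
  simp only [Finset.mem_filter, Finset.mem_univ, true_and] at hH hK
  exact hx.mul_eq_zero H K (fun h => hK.2 (hH.1.trans h)) (fun h => hH.2 (hK.1.trans h))

lemma mul_upSum (hx : FlatRelations rk x) {F G : L} (h : ¬ G ≤ F) :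
    x F * upSum x G = x F * upSum x (F ⊔ G) := by
  rw [← sub_eq_zero, ← mul_sub, sup_comm, upSum_sub, Finset.mul_sum]
  refine Finset.sum_eq_zero fun H hH => ?_
  simp only [Finset.mem_filter, Finset.mem_univ, true_and] at hH
  exact hx.mul_eq_zero F H hH.2 fun e => h (hH.1.trans e)

variable [BoundedOrder L]

/-- Write G = F ∨ A with A an atom; x_F does not distinguish h_G from h_A, and h_A = 0. -/
lemma mul_upSum_cover (hrk : IsGeometricRank rk) (hx : FlatRelations rk x) {F G : L} (h : F ≤ G)
    (h' : rk G = rk F + 1) : x F * upSum x G = 0 := by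
  have hlt : F < G := lt_of_le_of_ne h fun e => by subst e; omega
  obtain ⟨A, hA, hAG, hAF⟩ := hrk.exists_atom F G hlt
  have : F ⊔ A = G := hrk.eq_of_le (sup_le h hAG) (by rw [hrk.sup_atom hA hAF]; omega)
  rw [← this, ← hx.mul_upSum hAF, hx.atom hA, mul_zero]

/-- This is the square relation for F and an atom A with F ∨ A = G, where h_A = 0. -/
lemma cover_mul (hrk : IsGeometricRank rk) (hx : FlatRelations rk x) {F G : L} (h : F ≤ G)
    (h' : rk F + 1 = rk G) : upSum x G * upSum x F = upSum x G * upSum x G := by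
  have hlt : F < G := lt_of_le_of_ne h fun e => by subst e; omega
  obtain ⟨A, hA, hAG, hAF⟩ := hrk.exists_atom F G hlt
  have : F ⊔ A = G := hrk.eq_of_le (sup_le h hAG) (by rw [hrk.sup_atom hA hAF]; omega)
  have h1 := hx.square F A
  rw [this, hx.atom hA] at h1
  linear_combination -h1

lemma mul_of_incomparable (hx : FlatRelations rk x) (F G : L) :
    upSum x F * upSum x G = upSum x F * upSum x (F ⊔ G) + upSum x (F ⊔ G) * upSum x G
      - upSum x (F ⊔ G) * upSum x (F ⊔ G) := by
  linear_combination hx.square F G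

/-- One copy of h_T lets every other copy be lowered to a coatom K, by `cover_mul`. This is what
shrinks the interval in `mul_upMon_eq_zero`. -/
lemma upMon_cons_map (hrk : IsGeometricRank rk) (hx : FlatRelations rk x) {K T : L} (h : K ≤ T)
    (h' : rk K + 1 = rk T) (S : Multiset L) :
    upSum x T * upMon x (S.map fun G => if G = T then K else G) = upSum x T * upMon x S := by
  induction S using Multiset.induction_on with
  | empty => simp
  | cons G S ih =>
    rw [Multiset.map_cons, upMon_cons, upMon_cons, mul_left_comm, ih]
    split_ifs with hG
    · subst hG
      linear_combination upMon x S * (hx.cover_mul hrk h h')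
    · ring

lemma chain_bound (hrk : IsGeometricRank rk) {F T : L} (hFT : F < T) {S : Multiset L}
    (hF : ∀ G ∈ S, F < G) (hT : ∀ G ∈ S, G ≤ T) (hS : ∀ G ∈ S, ∀ H ∈ S, G ≤ H ∨ H ≤ G) :
    ∃ K, F ≤ K ∧ K < T ∧ ∀ G ∈ S, G ≠ T → G ≤ K := by
  obtain ⟨K, hK, hmax⟩ := (insert F (S.toFinset.filter (· ≠ T))).exists_max_image rk
    ⟨F, Finset.mem_insert_self _ _⟩
  simp only [Finset.mem_insert, Finset.mem_filter, Multiset.mem_toFinset] at hK hmax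
  rcases hK with rfl | ⟨hK, hKT⟩
  · exact ⟨K, le_rfl, hFT, fun G hG hGT =>
      absurd (hrk.strictMono (hF G hG)) (by have := hmax G (Or.inr ⟨hG, hGT⟩); omega)⟩
  · refine ⟨K, (hF K hK).le, lt_of_le_of_ne (hT K hK) hKT, fun G hG hGT => ?_⟩
    rcases hS G hG K hK with h | h
    · exact h
    · exact (hrk.eq_of_le h (hmax G (Or.inr ⟨hG, hGT⟩))).ge

/-- If `y` annihilates `h_{F'}` for all covers `F'` of `F`, then it annihilates all monomials in the
interval above `F` whose degree is at least the relative rank of an upper bound. -/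
lemma mul_upMon_eq_zero (hrk : IsGeometricRank rk) (hx : FlatRelations rk x) {y : R} {F : L}
    (hy : ∀ G, F ≤ G → rk G = rk F + 1 → y * upSum x G = 0) (S : Multiset L) (T : L) (hFT : F < T)
    (hF : ∀ G ∈ S, F < G) (hT : ∀ G ∈ S, G ≤ T) (hc : rk T ≤ rk F + S.card) :
    y * upMon x S = 0 := by
  obtain ⟨n, hn⟩ : ∃ n, S.card = n := ⟨_, rfl⟩
  induction n generalizing S T with
  | zero =>
    have := hrk.strictMono hFT
    omega
  | succ n ih =>
    -- The outer induction on the degree shrinks T; the inner one on total corank, with T fixed,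
    -- straightens S to a chain.
    obtain ⟨w, hw⟩ : ∃ w, corankSum rk S = w := ⟨_, rfl⟩
    induction w using Nat.strong_induction_on generalizing S with
    | _ w ihw =>
    by_cases hS : ∀ G ∈ S, ∀ H ∈ S, G ≤ H ∨ H ≤ G
    · obtain ⟨K₀, hFK₀, hK₀T, hK₀⟩ := chain_bound hrk hFT hF hT hS
      obtain ⟨K, hK₀K, hKT, hK⟩ := hrk.exists_cover_below hK₀T
      have hSK : ∀ G ∈ S, G ≠ T → G ≤ K := fun G hG h => (hK₀ G hG h).trans hK₀K
      have hFK := hFK₀.trans hK₀K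
      by_cases hTS : T ∈ S
      · obtain ⟨S', rfl⟩ := Multiset.exists_cons_of_mem hTS
        -- Split off one h_T and lower the others to h_K: the degree and the rank of the upper bound
        -- both drop by one.
        rw [upMon_cons, ← hx.upMon_cons_map hrk hKT.le hK]
        rcases eq_or_lt_of_le hFK with rfl | hFK
        · rw [← mul_assoc, hy T hFT.le hK.symm, zero_mul]
        · rw [mul_left_comm, ih _ K hFK, mul_zero]
          · intro G hG
            obtain ⟨G', hG', rfl⟩ := Multiset.mem_map.1 hG
            split_ifs
            · exact hFK
            · exact hF _ (Multiset.mem_cons_of_mem hG')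
          · intro G hG
            obtain ⟨G', hG', rfl⟩ := Multiset.mem_map.1 hG
            split_ifs with h
            · exact le_rfl
            · exact hSK _ (Multiset.mem_cons_of_mem hG') h
          · simp only [Multiset.card_map, Multiset.card_cons] at hc ⊢
            omega
          · simpa using hn
      · obtain ⟨G, hG⟩ := Multiset.card_pos_iff_exists_mem.1 (by omega : 0 < S.card)
        obtain ⟨S', rfl⟩ := Multiset.exists_cons_of_mem hG
        have hne : ∀ H ∈ G ::ₘ S', H ≠ T := fun H hH e => hTS (e ▸ hH)
        have hFK : F < K := (hF G hG).trans_le (hSK G hG (hne G hG))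
        rw [upMon_cons, mul_left_comm, ih S' K hFK, mul_zero]
        · exact fun H hH => hF H (Multiset.mem_cons_of_mem hH)
        · exact fun H hH => hSK H (Multiset.mem_cons_of_mem hH) (hne H (Multiset.mem_cons_of_mem hH))
        · simp only [Multiset.card_cons] at hc
          omega
        · simpa using hn
    · push Not at hS
      obtain ⟨G, hG, H, hH, hGH, hHG⟩ := hS
      obtain ⟨S₁, rfl⟩ := Multiset.exists_cons_of_mem hG
      have hH' : H ∈ S₁ := (Multiset.mem_cons.1 hH).resolve_left fun e => hGH e.ge
      obtain ⟨S₂, rfl⟩ := Multiset.exists_cons_of_mem hH'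
      simp only [Multiset.mem_cons, forall_eq_or_imp, Multiset.card_cons, corankSum_cons]
        at hF hT hc hn hw
      have hG' : rk G < rk (G ⊔ H) :=
        hrk.strictMono (lt_of_le_of_ne le_sup_left fun e => hHG (e ▸ le_sup_right))
      have hH'' : rk H < rk (G ⊔ H) :=
        hrk.strictMono (lt_of_le_of_ne le_sup_right fun e => hGH (e ▸ le_sup_left))
      have htop := hrk.le_top (G ⊔ H)
      have hU : F < G ⊔ H := hF.1.trans_le le_sup_left
      have hU' : G ⊔ H ≤ T := sup_le hT.1 hT.2.1
      have key : ∀ A B, (F < A ∧ F < B ∧ A ≤ T ∧ B ≤ T) →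
          rk G + rk H < rk A + rk B → y * upMon x (A ::ₘ B ::ₘ S₂) = 0 := by
        intro A B hAB hlt
        have hA := hrk.le_top A
        have hB := hrk.le_top B
        refine ihw (corankSum rk (A ::ₘ B ::ₘ S₂)) ?_ _ ?_ ?_ ?_ ?_ rfl
        · simp only [corankSum_cons]
          omega
        · simpa using ⟨hAB.1, hAB.2.1, hF.2.2⟩
        · simpa using ⟨hAB.2.2.1, hAB.2.2.2, hT.2.2⟩
        · simpa using hc
        · simpa using hn
      have k1 := key G (G ⊔ H) ⟨hF.1, hU, hT.1, hU'⟩ (by omega)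
      have k2 := key (G ⊔ H) H ⟨hU, hF.2.1, hU', hT.2.1⟩ (by omega)
      have k3 := key (G ⊔ H) (G ⊔ H) ⟨hU, hU, hU', hU'⟩ (by omega)
      simp only [upMon_cons] at k1 k2 k3 ⊢
      linear_combination y * upMon x S₂ * (hx.mul_of_incomparable G H) + k1 + k2 - k3

lemma x_mul_upMon_sup (hx : FlatRelations rk x) {F : L} (S : Multiset L) (hS : ∀ G ∈ S, ¬ G ≤ F) :
    x F * upMon x S = x F * upMon x (S.map (F ⊔ ·)) := by
  induction S using Multiset.induction_on with
  | empty => simp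
  | cons G S ih =>
    simp only [Multiset.mem_cons, forall_eq_or_imp] at hS
    rw [Multiset.map_cons, upMon_cons, upMon_cons, mul_left_comm, ih hS.2, mul_left_comm,
      ← mul_assoc, hx.mul_upSum hS.1, mul_assoc]

/-- Next to x_F each h_G may be replaced by h_{F∨G}. This moves the monomial into the interval above
F, where x_F kills the covers and `mul_upMon_eq_zero` applies. -/
lemma x_mul_upMon_eq_zero (hrk : IsGeometricRank rk) (hx : FlatRelations rk x) {F : L} (hF : F < ⊤)
    (S : Multiset L) (hS : ∀ G ∈ S, ¬ G ≤ F) (hc : rk ⊤ ≤ rk F + S.card) :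
    x F * upMon x S = 0 := by
  rw [hx.x_mul_upMon_sup S hS]
  refine mul_upMon_eq_zero hrk hx (fun G h h' => hx.mul_upSum_cover hrk h h') _ ⊤ hF ?_
    (fun _ _ => _root_.le_top) (by simpa using hc)
  intro G hG
  obtain ⟨H, hH, rfl⟩ := Multiset.mem_map.1 hG
  exact lt_of_le_of_ne le_sup_left fun e => hS H hH (e ▸ le_sup_right)

/-- The ideal generated by the `h_G` with `G ≰ F`. -/
def upIdeal (x : L → R) (F : L) : Ideal R := Ideal.span (upSum x '' {G | ¬ G ≤ F})

lemma x_mul_upIdeal_pow (hrk : IsGeometricRank rk) (hx : FlatRelations rk x) {F : L} (hF : F < ⊤)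
    {s : ℕ} (hs : rk ⊤ ≤ rk F + s) {u : R} (hu : u ∈ upIdeal x F ^ s) : x F * u = 0 := by
  -- S collects the generators already extracted from the ideal power, so that the end of the
  -- induction is the monomial case.
  suffices H : ∀ (s : ℕ) (S : Multiset L), (∀ G ∈ S, ¬ G ≤ F) → rk ⊤ ≤ rk F + (S.card + s) →
      ∀ u ∈ upIdeal x F ^ s, x F * upMon x S * u = 0 by
    simpa using H s 0 (by simp) (by simpa using hs) u hu
  intro s
  induction s with
  | zero =>
    intro S hS hc u _
    rw [hx.x_mul_upMon_eq_zero hrk hF S hS hc, zero_mul]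
  | succ s ih =>
    intro S hS hc u hu
    rw [pow_succ'] at hu
    refine Submodule.mul_induction_on hu (fun a ha b hb => ?_) fun a b h h' => by
      rw [mul_add, h, h', add_zero]
    induction ha using Submodule.span_induction with
    | mem a ha =>
      obtain ⟨G, hG, rfl⟩ := ha
      have := ih (G ::ₘ S) (by simpa using ⟨hG, hS⟩) (by simp; omega) b hb
      rw [upMon_cons] at this
      linear_combination this
    | zero => simp
    | add a a' _ _ h h' => rw [add_mul, mul_add, h, h', add_zero]
    | smul c a _ h =>
      rw [smul_eq_mul]
      linear_combination c * h

lemma upSum_mem_upIdeal {F G : L} (h : ¬ G ≤ F) : upSum x G ∈ upIdeal x F :=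
  Ideal.subset_span ⟨G, h, rfl⟩

lemma x_eq (x : L → R) (F : L) : x F = upSum x F - ∑ G with F < G, x G := by
  have : (Finset.univ.filter fun G => F ≤ G) = insert F (Finset.univ.filter fun G => F < G) := by
    ext a
    simp [le_iff_eq_or_lt, eq_comm]
  rw [upSum, this, Finset.sum_insert (by simp), add_sub_cancel_right]

lemma x_mem_upIdeal {F G : L} (h : ¬ G ≤ F) : x G ∈ upIdeal x F := by
  induction G using (wellFounded_gt (α := L)).induction with
  | _ G ih =>
  rw [x_eq x G]
  refine sub_mem (upSum_mem_upIdeal h) (sum_mem fun H hH => ?_)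
  have hGH : G < H := by simpa using hH
  exact ih H hGH fun e => h (hGH.le.trans e)

end FlatRelations

end Relations

/-! ### Feichtner–Yuzvinsky monomials. -/

section Basis

variable {L : Type*} [Lattice L] [BoundedOrder L] [Fintype L] {rk : L → ℕ}

/-- The Feichtner–Yuzvinsky monomials with largest flat `G`. -/
noncomputable def basisAt (rk : L → ℕ) (G : L) : Finset (Multiset L) :=
  if G = ⊥ then {0} else
    (Finset.univ.filter (· < G)).attach.biUnion fun F =>
      have : F.1 < G := (Finset.mem_filter.1 F.2).2
      (Finset.Ico 1 (rk G - rk F)).biUnion fun a =>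
        (basisAt rk F.1).image (· + Multiset.replicate a G)
termination_by (wellFounded_lt (α := L)).wrap G
decreasing_by exact this

/-- The Feichtner–Yuzvinsky monomials. -/
noncomputable def basis (rk : L → ℕ) : Finset (Multiset L) := Finset.univ.biUnion (basisAt rk)

lemma basisAt_bot : basisAt rk (⊥ : L) = {0} := by
  rw [basisAt, if_pos rfl]

lemma mem_basisAt_of_ne {G : L} (hG : G ≠ ⊥) {S : Multiset L} :
    S ∈ basisAt rk G ↔ ∃ F < G, ∃ a, 1 ≤ a ∧ a + rk F < rk G ∧ ∃ S' ∈ basisAt rk F,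
      S = S' + Multiset.replicate a G := by
  rw [basisAt, if_neg hG]
  simp only [Finset.mem_biUnion, Finset.mem_attach, true_and, Subtype.exists, Finset.mem_filter,
    Finset.mem_univ, Finset.mem_Ico, Finset.mem_image]
  constructor
  · rintro ⟨F, hF, a, ⟨ha, ha'⟩, S', hS', rfl⟩
    exact ⟨F, hF, a, ha, by omega, S', hS', rfl⟩
  · rintro ⟨F, hF, a, ha, ha', S', hS', rfl⟩
    exact ⟨F, hF, a, ⟨ha, by omega⟩, S', hS', rfl⟩

lemma basisAt_induction {P : L → Multiset L → Prop} (bot : P ⊥ 0)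
    (step : ∀ F G S a, F < G → 1 ≤ a → a + rk F < rk G → S ∈ basisAt rk F → P F S →
      P G (S + Multiset.replicate a G)) {G : L} {S : Multiset L} (h : S ∈ basisAt rk G) : P G S := by
  induction G using (wellFounded_lt (α := L)).induction generalizing S with
  | _ G ih =>
  by_cases hG : G = ⊥
  · subst hG
    rw [basisAt_bot, Finset.mem_singleton] at h
    exact h ▸ bot
  · obtain ⟨F, hF, a, ha, ha', S', hS', rfl⟩ := (mem_basisAt_of_ne hG).1 h
    exact step F G S' a hF ha ha' hS' (ih F hF hS')

lemma le_of_mem_basisAt {G : L} {S : Multiset L} (h : S ∈ basisAt rk G) : ∀ H ∈ S, H ≤ G := by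
  refine basisAt_induction (P := fun G S => ∀ H ∈ S, H ≤ G) (by simp) ?_ h
  intro F G S a hF _ _ _ ih H hH
  rcases Multiset.mem_add.1 hH with hH | hH
  · exact (ih H hH).trans hF.le
  · exact (Multiset.eq_of_mem_replicate hH).le

lemma eq_bot_or_mem {G : L} {S : Multiset L} (h : S ∈ basisAt rk G) : (G = ⊥ ∧ S = 0) ∨ G ∈ S := by
  refine basisAt_induction (P := fun G S => (G = ⊥ ∧ S = 0) ∨ G ∈ S) (by simp) ?_ h
  intro F G S a hF ha _ _ _
  exact Or.inr (Multiset.mem_add.2 (Or.inr (Multiset.mem_replicate.2 ⟨by omega, rfl⟩)))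

lemma bot_notMem_of_mem_basisAt {G : L} {S : Multiset L} (h : S ∈ basisAt rk G) : ⊥ ∉ S := by
  refine basisAt_induction (P := fun G S => ⊥ ∉ S) (by simp) ?_ h
  intro F G S a hF _ _ _ ih hmem
  rcases Multiset.mem_add.1 hmem with hH | hH
  · exact ih hH
  · exact absurd hF (Multiset.eq_of_mem_replicate hH ▸ not_lt_bot)

lemma chain_of_mem_basisAt {G : L} {S : Multiset L} (h : S ∈ basisAt rk G) :
    ∀ H ∈ S, ∀ K ∈ S, H ≤ K ∨ K ≤ H := by
  refine basisAt_induction (P := fun G S => ∀ H ∈ S, ∀ K ∈ S, H ≤ K ∨ K ≤ H) (by simp) ?_ h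
  intro F G S a hF _ _ hS ih H hH K hK
  rcases Multiset.mem_add.1 hH with hH | hH <;> rcases Multiset.mem_add.1 hK with hK | hK
  · exact ih H hH K hK
  · exact Or.inl (Multiset.eq_of_mem_replicate hK ▸ (le_of_mem_basisAt hS H hH).trans hF.le)
  · exact Or.inr (Multiset.eq_of_mem_replicate hH ▸ (le_of_mem_basisAt hS K hK).trans hF.le)
  · rw [Multiset.eq_of_mem_replicate hH, Multiset.eq_of_mem_replicate hK]
    exact Or.inl le_rfl

/-- The recursion only tests the exponent of a flat against its predecessor in the chain; the
hypotheses test it against ⊥ and all smaller members. Stripping the largest flat preserves them. -/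
lemma exists_mem_basisAt (hrk : IsGeometricRank rk) (S : Multiset L)
    (hS : ∀ H ∈ S, ∀ K ∈ S, H ≤ K ∨ K ≤ H) (hbot : ∀ G ∈ S, S.count G < rk G)
    (hlt : ∀ F ∈ S, ∀ G ∈ S, F < G → S.count G + rk F < rk G) : ∃ G, S ∈ basisAt rk G := by
  obtain ⟨n, hn⟩ : ∃ n, S.card = n := ⟨_, rfl⟩
  induction n using Nat.strong_induction_on generalizing S with
  | _ n ih =>
  by_cases h0 : S = 0
  · exact ⟨⊥, by rw [basisAt_bot, h0, Finset.mem_singleton]⟩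
  obtain ⟨T, hT, hmax⟩ := Multiset.exists_max_image rk h0
  have hle : ∀ H ∈ S, H ≤ T := fun H hH => by
    rcases hS H hH T hT with h | h
    · exact h
    · exact (hrk.eq_of_le h (hmax H hH)).ge
  set S' := S.filter (fun H => ¬ H = T) with hS'
  have hdec : S' + Multiset.replicate (S.count T) T = S := by
    rw [hS', ← Multiset.filter_eq', add_comm, Multiset.filter_add_not]
  have hpos : 0 < S.count T := Multiset.count_pos.2 hT
  have hcard : S'.card + S.count T = S.card := by
    conv_rhs => rw [← hdec]
    simp
  have hsub : ∀ H ∈ S', H ∈ S ∧ H ≠ T := fun H hH => Multiset.mem_filter.1 hH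
  have hcount : ∀ H ∈ S', S'.count H = S.count H := fun H hH => by
    rw [hS', Multiset.count_filter, if_pos (hsub H hH).2]
  obtain ⟨F, hF⟩ := ih S'.card (by omega) S' (fun H hH K hK => hS H (hsub H hH).1 K (hsub K hK).1)
    (fun G hG => by rw [hcount G hG]; exact hbot G (hsub G hG).1)
    (fun F hF G hG h => by rw [hcount G hG]; exact hlt F (hsub F hF).1 G (hsub G hG).1 h) rfl
  have hTb : T ≠ ⊥ := fun e => by
    have := hbot T hT
    rw [e, hrk.bot] at this
    omega
  refine ⟨T, (mem_basisAt_of_ne hTb).2 ⟨F, ?_, S.count T, hpos, ?_, S', hF, hdec.symm⟩⟩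
  · rcases eq_bot_or_mem hF with h | h
    · exact h.1 ▸ bot_lt_iff_ne_bot.2 hTb
    · exact lt_of_le_of_ne (hle F (hsub F h).1) (hsub F h).2
  · rcases eq_bot_or_mem hF with h | h
    · rw [h.1, hrk.bot]
      exact hbot T hT
    · exact hlt F (hsub F h).1 T hT (lt_of_le_of_ne (hle F (hsub F h).1) (hsub F h).2)

end Basis

/-! ### Straightening: the basis monomials span. -/

section Spanning

variable {L R : Type*} [Lattice L] [BoundedOrder L] [Fintype L] [CommRing R] {rk : L → ℕ} {x : L → R}

namespace FlatRelations

/-- The vanishing result for the interval [⊥, G] with y = 1: the covers of ⊥ are the atoms. -/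
lemma upSum_pow_eq_zero (hrk : IsGeometricRank rk) (hx : FlatRelations rk x) {G : L} (hG : G ≠ ⊥)
    {n : ℕ} (hn : rk G ≤ n) : upSum x G ^ n = 0 := by
  have hG' : ⊥ < G := bot_lt_iff_ne_bot.2 hG
  have := hx.mul_upMon_eq_zero hrk (y := 1) (F := ⊥)
    (fun H _ hH => by rw [hx.atom (by rw [hH, hrk.bot]), mul_zero]) (Multiset.replicate n G) G hG'
    (fun H hH => by rwa [Multiset.eq_of_mem_replicate hH])
    (fun H hH => (Multiset.eq_of_mem_replicate hH).le) (by simpa [hrk.bot] using hn)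
  simpa using this

/-- Climb a maximal chain from F to G: with K a coatom of [F, G], multiply the identity for K by h_G
and turn each h_K into h_G. -/
lemma upSum_mul_pow (hrk : IsGeometricRank rk) (hx : FlatRelations rk x) {F G : L} (h : F ≤ G)
    {d : ℕ} (hd : rk F + d = rk G) : upSum x F * upSum x G ^ d = upSum x G ^ (d + 1) := by
  induction d generalizing G with
  | zero =>
    rw [hrk.eq_of_le h (by omega)]
    simp
  | succ d ih =>
    have hlt : F < G := lt_of_le_of_ne h fun e => by subst e; omega
    obtain ⟨K, h1, h2, h3⟩ := hrk.exists_cover_below hlt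
    have hc := hx.cover_mul hrk h2.le h3
    have hpow : ∀ n : ℕ, upSum x G * upSum x K ^ n = upSum x G * upSum x G ^ n := by
      intro n
      induction n with
      | zero => simp
      | succ n ihn =>
        rw [pow_succ, ← mul_assoc, ihn, mul_right_comm, hc]
        ring
    have := ih h1 (by omega)
    have h4 := congrArg (upSum x G * ·) this
    rw [hpow, mul_left_comm, hpow] at h4
    rw [pow_succ', h4]
    ring

/-- A multiset fails to be basic in three ways: an incomparable pair is rewritten by joins, an
exponent of G reaching rk G gives zero, and an exponent of G reaching rk G - rk F absorbs the
smaller factor h_F. The rewritings keep the degree and lower the total corank. -/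
lemma upMon_mem_span (hrk : IsGeometricRank rk) (hx : FlatRelations rk x) (S : Multiset L)
    (hS : ⊥ ∉ S) :
    upMon x S ∈ Submodule.span ℤ (upMon x '' {m | m ∈ basis rk ∧ m.card = S.card}) := by
  obtain ⟨w, hw⟩ : ∃ w, corankSum rk S = w := ⟨_, rfl⟩
  induction w using Nat.strong_induction_on generalizing S with
  | _ w ih =>
  by_cases hchain : ∀ G ∈ S, ∀ H ∈ S, G ≤ H ∨ H ≤ G
  swap
  · push Not at hchain
    obtain ⟨G, hG, H, hH, hGH, hHG⟩ := hchain
    obtain ⟨S₁, rfl⟩ := Multiset.exists_cons_of_mem hG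
    have hH' : H ∈ S₁ := (Multiset.mem_cons.1 hH).resolve_left fun e => hGH e.ge
    obtain ⟨S₂, rfl⟩ := Multiset.exists_cons_of_mem hH'
    simp only [Multiset.mem_cons, not_or, corankSum_cons] at hS hw
    have hG' : rk G < rk (G ⊔ H) :=
      hrk.strictMono (lt_of_le_of_ne le_sup_left fun e => hHG (e ▸ le_sup_right))
    have hH'' : rk H < rk (G ⊔ H) :=
      hrk.strictMono (lt_of_le_of_ne le_sup_right fun e => hGH (e ▸ le_sup_left))
    have htop := hrk.le_top (G ⊔ H)
    have hU : ⊥ ≠ G ⊔ H := fun e => by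
      rw [← e, hrk.bot] at hG'
      omega
    have key : ∀ A B, ⊥ ≠ A → ⊥ ≠ B → rk G + rk H < rk A + rk B →
        upMon x (A ::ₘ B ::ₘ S₂) ∈ Submodule.span ℤ
          (upMon x '' {m | m ∈ basis rk ∧ m.card = (G ::ₘ H ::ₘ S₂).card}) := by
      intro A B hA hB hlt
      have hA' := hrk.le_top A
      have hB' := hrk.le_top B
      have := ih (corankSum rk (A ::ₘ B ::ₘ S₂)) (by simp only [corankSum_cons]; omega)
        (A ::ₘ B ::ₘ S₂) (by simp [hA, hB, hS.2.2]) rfl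
      simpa using this
    have k1 := key G (G ⊔ H) hS.1 hU (by omega)
    have k2 := key (G ⊔ H) H hU hS.2.1 (by omega)
    have k3 := key (G ⊔ H) (G ⊔ H) hU hU (by omega)
    have : upMon x (G ::ₘ H ::ₘ S₂) = upMon x (G ::ₘ (G ⊔ H) ::ₘ S₂)
        + upMon x ((G ⊔ H) ::ₘ H ::ₘ S₂) - upMon x ((G ⊔ H) ::ₘ (G ⊔ H) ::ₘ S₂) := by
      simp only [upMon_cons]
      linear_combination upMon x S₂ * (hx.mul_of_incomparable G H)
    rw [this]
    exact sub_mem (add_mem k1 k2) k3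
  by_cases hcount : ∀ G ∈ S, S.count G < rk G
  swap
  · push Not at hcount
    obtain ⟨G, hG, hc⟩ := hcount
    have hle : Multiset.replicate (S.count G) G ≤ S := Multiset.le_count_iff_replicate_le.1 le_rfl
    obtain ⟨S', hS'⟩ := Multiset.le_iff_exists_add.1 hle
    have h0 : upMon x S = 0 := by
      rw [hS', upMon_add, upMon_replicate,
        hx.upSum_pow_eq_zero hrk (fun e => hS (e ▸ hG)) hc, zero_mul]
    rw [h0]
    exact zero_mem _
  by_cases hlt : ∀ F ∈ S, ∀ G ∈ S, F < G → S.count G + rk F < rk G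
  · obtain ⟨G, hG⟩ := exists_mem_basisAt hrk S hchain hcount hlt
    exact Submodule.subset_span
      ⟨S, ⟨Finset.mem_biUnion.2 ⟨G, Finset.mem_univ _, hG⟩, rfl⟩, rfl⟩
  push Not at hlt
  obtain ⟨F, hF, G, hG, hFG, hc⟩ := hlt
  have hrkFG := hrk.strictMono hFG
  obtain ⟨S₁, rfl⟩ := Multiset.exists_cons_of_mem hF
  have hle : Multiset.replicate (rk G - rk F) G ≤ S₁ := by
    rw [← Multiset.le_count_iff_replicate_le]
    rw [Multiset.count_cons_of_ne hFG.ne'] at hc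
    omega
  -- The factor h_F and rk G - rk F copies of h_G become rk G - rk F + 1 copies of h_G.
  obtain ⟨S₂, rfl⟩ := Multiset.le_iff_exists_add.1 hle
  have htop := hrk.le_top G
  have := ih (corankSum rk (Multiset.replicate (rk G - rk F + 1) G + S₂)) (by
      rw [← hw]
      simp only [corankSum_cons, corankSum_add, corankSum_replicate, add_mul, one_mul]
      generalize (rk G - rk F) * (rk ⊤ - rk G) = z
      omega) (Multiset.replicate (rk G - rk F + 1) G + S₂) (by
      simp only [Multiset.mem_add, Multiset.mem_cons, not_or] at hS ⊢
      exact ⟨fun e => hFG.ne_bot (Multiset.eq_of_mem_replicate e).symm, hS.2.2⟩) rfl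
  have heq : upMon x (F ::ₘ (Multiset.replicate (rk G - rk F) G + S₂))
      = upMon x (Multiset.replicate (rk G - rk F + 1) G + S₂) := by
    rw [upMon_cons, upMon_add, upMon_add, upMon_replicate, upMon_replicate, ← mul_assoc,
      hx.upSum_mul_pow hrk hFG.le (by omega)]
  rw [heq]
  convert this using 5
  simp

end FlatRelations

end Spanning

/-! ### Test elements and linear independence. -/

section Independence

variable {L R : Type*} [Lattice L] [BoundedOrder L] [Fintype L] [CommRing R] {rk : L → ℕ} {x : L → R}

lemma bot_notMem_of_mem_basis {m : Multiset L} (h : m ∈ basis rk) : ⊥ ∉ m := by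
  obtain ⟨G, -, hG⟩ := Finset.mem_biUnion.1 h
  exact bot_notMem_of_mem_basisAt hG

lemma chain_of_mem_basis {m : Multiset L} (h : m ∈ basis rk) :
    ∀ H ∈ m, ∀ K ∈ m, H ≤ K ∨ K ≤ H := by
  obtain ⟨G, -, hG⟩ := Finset.mem_biUnion.1 h
  exact chain_of_mem_basisAt hG

lemma imp_of_countP_eq {S : Multiset L} {p q : L → Prop} [DecidablePred p] [DecidablePred q]
    (h : ∀ H ∈ S, p H → q H)
    (h' : S.countP q ≤ S.countP p) : ∀ H ∈ S, q H → p H := by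
  have hle : S.filter p ≤ S.filter q := by
    rw [Multiset.le_filter]
    exact ⟨Multiset.filter_le _ _, fun a ha =>
      h a (Multiset.mem_filter.1 ha).1 (Multiset.mem_filter.1 ha).2⟩
  have heq := Multiset.eq_of_le_of_card_le hle (by
    rwa [← Multiset.countP_eq_card_filter, ← Multiset.countP_eq_card_filter])
  intro H hH hq
  have : H ∈ S.filter p := heq ▸ Multiset.mem_filter.2 ⟨hH, hq⟩
  exact (Multiset.mem_filter.1 this).2

lemma countP_le_of_imp {S : Multiset L} {p q : L → Prop} [DecidablePred p] [DecidablePred q]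
    (h : ∀ H ∈ S, p H → q H) :
    S.countP p ≤ S.countP q := by
  rw [Multiset.countP_eq_card_filter, Multiset.countP_eq_card_filter]
  refine Multiset.card_le_card ?_
  rw [Multiset.le_filter]
  exact ⟨Multiset.filter_le _ _, fun a ha =>
    h a (Multiset.mem_filter.1 ha).1 (Multiset.mem_filter.1 ha).2⟩

/-- The corank of G counts the thresholds ρ with rk G ≤ ρ < rk ⊤; exchange the summations. -/
lemma corankSum_eq_sum (S : Multiset L) :
    corankSum rk S = ∑ ρ ∈ Finset.range (rk ⊤), S.countP (fun G => rk G ≤ ρ) := by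
  induction S using Multiset.induction_on with
  | empty => simp
  | cons G S ih =>
    simp only [corankSum_cons, ih, Multiset.countP_cons, Finset.sum_add_distrib]
    rw [add_comm]
    congr 1
    rw [Finset.sum_boole, Nat.cast_id]
    have : (Finset.range (rk ⊤)).filter (fun ρ => rk G ≤ ρ) = Finset.Ico (rk G) (rk ⊤) := by
      ext ρ
      simp only [Finset.mem_filter, Finset.mem_range, Finset.mem_Ico]
      omega
    rw [this, Nat.card_Ico]

lemma countP_rank_eq (S : Multiset L) (ρ : ℕ) :
    S.countP (fun G => rk G ≤ ρ) = S.countP (fun G => rk G < ρ) + S.countP (fun G => rk G = ρ) := by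
  induction S using Multiset.induction_on with
  | empty => simp
  | cons G S ih =>
    simp only [Multiset.countP_cons, ih]
    split_ifs <;> omega

/-- A basis monomial `m` is determined among the monomials of its degree that have at least as many
factors as `m` below each factor of `m` by having maximal total corank. -/
lemma eq_of_countP_le (hrk : IsGeometricRank rk) {m n : Multiset L}
    (hm : ∀ H ∈ m, ∀ K ∈ m, H ≤ K ∨ K ≤ H) (hcard : n.card = m.card)
    (h : ∀ F ∈ m, m.countP (· ≤ F) ≤ n.countP (· ≤ F)) (hc : corankSum rk n ≤ corankSum rk m) :
    n = m := by
  have hle : ∀ F ∈ m, ∀ H ∈ m, rk H ≤ rk F → H ≤ F := fun F hF H hH hr => by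
    rcases hm H hH F hF with h1 | h1
    · exact h1
    · exact (hrk.eq_of_le h1 hr).ge
  have hbelow : ∀ (S : Multiset L) F, S.countP (· ≤ F) ≤ S.countP (fun G => rk G ≤ rk F) :=
    fun S F => countP_le_of_imp fun H _ hH => hrk.strictMono.monotone hH
  have hbelow' : ∀ F ∈ m, m.countP (fun G => rk G ≤ rk F) ≤ m.countP (· ≤ F) :=
    fun F hF => countP_le_of_imp fun H hH hr => hle F hF H hH hr
  -- As m is a chain, its members of rank at most ρ are those below the largest of them, F.
  have hthr : ∀ ρ, m.countP (fun G => rk G ≤ ρ) ≤ n.countP (fun G => rk G ≤ ρ) := by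
    intro ρ
    by_cases h0 : m.filter (fun G => rk G ≤ ρ) = 0
    · rw [Multiset.countP_eq_card_filter, h0]
      simp
    obtain ⟨F, hF, hmax⟩ := Multiset.exists_max_image rk h0
    simp only [Multiset.mem_filter] at hF hmax
    calc m.countP (fun G => rk G ≤ ρ) ≤ m.countP (· ≤ F) :=
          countP_le_of_imp fun H hH hr => hle F hF.1 H hH (hmax H ⟨hH, hr⟩)
      _ ≤ n.countP (· ≤ F) := h F hF.1
      _ ≤ n.countP (fun G => rk G ≤ ρ) :=
          countP_le_of_imp fun H _ hH => (hrk.strictMono.monotone hH).trans hF.2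
  -- Total corank sums these counts, so the termwise inequality and the reverse inequality of the
  -- sums force equality.
  have heq : ∀ ρ, m.countP (fun G => rk G ≤ ρ) = n.countP (fun G => rk G ≤ ρ) := by
    intro ρ
    by_cases hρ : ρ < rk ⊤
    · rw [corankSum_eq_sum, corankSum_eq_sum] at hc
      exact (Finset.sum_eq_sum_iff_of_le fun ρ _ => hthr ρ).1
        (le_antisymm (Finset.sum_le_sum fun ρ _ => hthr ρ) hc) ρ (Finset.mem_range.2 hρ)
    · have : ∀ S : Multiset L, S.countP (fun G => rk G ≤ ρ) = S.card := fun S =>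
        Multiset.countP_eq_card.2 fun G _ => (hrk.le_top G).trans (by omega)
      rw [this, this, hcard]
  have heq' : ∀ ρ, m.countP (fun G => rk G = ρ) = n.countP (fun G => rk G = ρ) := by
    intro ρ
    have h1 := heq ρ
    rw [countP_rank_eq, countP_rank_eq] at h1
    cases ρ with
    | zero => simpa using h1
    | succ ρ =>
      have h2 := heq ρ
      simp only [Nat.lt_succ_iff] at h1
      omega
  have hn : ∀ F ∈ m, ∀ H ∈ n, rk H ≤ rk F → H ≤ F := fun F hF =>
    imp_of_countP_eq (fun H _ hH => hrk.strictMono.monotone hH) (by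
      have h1 := heq (rk F)
      have h2 := h F hF
      have h3 := hbelow' F hF
      omega)
  have hcount : ∀ (S : Multiset L) F, (∀ H ∈ S, rk H ≤ rk F → H ≤ F) →
      S.count F = S.countP (fun G => rk G = rk F) := by
    intro S F hS
    rw [Multiset.count]
    refine Multiset.countP_congr rfl fun H hH => ?_
    simp only [eq_iff_iff]
    exact ⟨fun e => e ▸ rfl, fun e => (hrk.eq_of_le (hS H hH e.le) e.ge).symm⟩
  refine (Multiset.eq_of_le_of_card_le (Multiset.le_iff_count.2 fun F => ?_) hcard.le).symm
  by_cases hF : F ∈ m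
  · rw [hcount m F (hle F hF), hcount n F (hn F hF), heq']
  · rw [Multiset.count_eq_zero_of_notMem hF]
    exact Nat.zero_le _

namespace FlatRelations

lemma upMon_mem_upIdeal_pow (S : Multiset L) (F : L) :
    upMon x S ∈ upIdeal x F ^ S.countP (fun G => ¬ G ≤ F) := by
  induction S using Multiset.induction_on with
  | empty => simp
  | cons G S ih =>
    rw [upMon_cons, Multiset.countP_cons]
    split_ifs with h
    · exact Ideal.mul_mem_left _ _ ih
    · rw [pow_succ']
      exact Ideal.mul_mem_mul (upSum_mem_upIdeal h) ih

lemma upSum_top (x : L → R) : upSum x ⊤ = x ⊤ := by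
  simp [upSum, Finset.sum_filter]

/-- For G < H < ⊤ the power h_⊤^c already kills x_H. So of the terms of h_G other than x_G only x_⊤
= h_⊤ survives. -/
lemma x_mul_top_pow (hrk : IsGeometricRank rk) (hx : FlatRelations rk x) {G : L} (hG : G < ⊤)
    {c : ℕ} (hc : rk G + c + 1 = rk ⊤) :
    x G * upSum x ⊤ ^ c = upSum x G * upSum x ⊤ ^ c - upSum x ⊤ ^ (c + 1) := by
  have : (∑ H with G < H, x H) * upSum x ⊤ ^ c = upSum x ⊤ ^ (c + 1) := by
    rw [Finset.sum_mul, Finset.sum_eq_single_of_mem ⊤ (by simpa using hG), pow_succ',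
      upSum_top x]
    intro H hH hH'
    have hr : rk G < rk H := hrk.strictMono (by simpa using hH)
    have hlt : H < ⊤ := lt_top_iff_ne_top.2 hH'
    have := hx.x_mul_upMon_eq_zero hrk hlt (Multiset.replicate c ⊤)
      (fun K hK => by rw [Multiset.eq_of_mem_replicate hK]; exact hlt.not_ge)
      (by rw [Multiset.card_replicate]; omega)
    simpa using this
  rw [x_eq x G, sub_mul, this]

lemma pow_mul_top_pow (hrk : IsGeometricRank rk) (hx : FlatRelations rk x) {G : L} {c : ℕ}
    (hc : rk G + c = rk ⊤) (n : ℕ) : upSum x G ^ n * upSum x ⊤ ^ c = upSum x ⊤ ^ (n + c) := by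
  induction n with
  | zero => simp
  | succ n ih =>
    rw [pow_succ', mul_assoc, ih, pow_add, mul_left_comm, hx.upSum_mul_pow hrk _root_.le_top hc,
      ← pow_add]
    congr 1
    omega

lemma x_mul_pow_eq_zero (hrk : IsGeometricRank rk) (hx : FlatRelations rk x) {F G : L} (h : F < G)
    {d : ℕ} (hd : rk G ≤ rk F + d) : x F * upSum x G ^ d = 0 := by
  have := mul_upMon_eq_zero hrk hx (y := x F) (F := F)
    (fun K h h' => hx.mul_upSum_cover hrk h h') (Multiset.replicate d G) G h
    (fun H hH => by rwa [Multiset.eq_of_mem_replicate hH])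
    (fun H hH => (Multiset.eq_of_mem_replicate hH).le) (by simpa using hd)
  simpa using this

/-- For m = ∏ h_{F_i}^{a_i} the test is τ = ∏ x_{F_i} h_{F_i}^{b_i} with a_i + b_i + 1 = rk F_i - rk
F_{i-1}. The product collapses from the top flat down, each x_{F_i} costing a sign. The last clause
records, for H in m, how many factors of τ besides x_H lie in the ideal of the h_G with G ≰ H. -/
lemma exists_test_of_lt_top (hrk : IsGeometricRank rk) (hx : FlatRelations rk x) {F : L}
    {m : Multiset L} (hm : m ∈ basisAt rk F) : F < ⊤ → ∃ τ : R,
      (upMon x m * τ * upSum x ⊤ ^ (rk ⊤ - 1 - rk F) = upSum x ⊤ ^ (rk ⊤ - 1) ∨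
        upMon x m * τ * upSum x ⊤ ^ (rk ⊤ - 1 - rk F) = -upSum x ⊤ ^ (rk ⊤ - 1)) ∧
      ∀ H ∈ m, ∃ t, t + m.countP (fun G => ¬ G ≤ H) + rk H = rk F ∧
        ∃ u ∈ upIdeal x H ^ t, τ = x H * u := by
  refine basisAt_induction (P := fun F m => F < ⊤ → ∃ τ : R,
      (upMon x m * τ * upSum x ⊤ ^ (rk ⊤ - 1 - rk F) = upSum x ⊤ ^ (rk ⊤ - 1) ∨
        upMon x m * τ * upSum x ⊤ ^ (rk ⊤ - 1 - rk F) = -upSum x ⊤ ^ (rk ⊤ - 1)) ∧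
      ∀ H ∈ m, ∃ t, t + m.countP (fun G => ¬ G ≤ H) + rk H = rk F ∧
        ∃ u ∈ upIdeal x H ^ t, τ = x H * u) ?_ ?_ hm
  · exact fun _ => ⟨1, Or.inl (by simp [hrk.bot]), by simp⟩
  intro F G m a hFG ha hlt hm ih hG
  obtain ⟨τ, hτ, hu⟩ := ih (hFG.trans hG)
  have hGt := hrk.strictMono hG
  obtain ⟨c, hc⟩ : ∃ c, rk G + c + 1 = rk ⊤ := ⟨rk ⊤ - 1 - rk G, by omega⟩
  obtain ⟨b, hb⟩ : ∃ b, a + rk F + b + 1 = rk G := ⟨rk G - rk F - a - 1, by omega⟩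
  -- The exponent is rk G - rk F: it kills x_F, which divides τ, and if F = ⊥ the power itself is
  -- zero.
  have hkill : upMon x m * τ * upSum x G ^ (a + b + 1) = 0 := by
    rcases eq_bot_or_mem hm with h | h
    · rw [hx.upSum_pow_eq_zero hrk (hFG.ne_bot) (by rw [h.1, hrk.bot] at hb; omega), mul_zero]
    · obtain ⟨t, -, u, -, rfl⟩ := hu F h
      linear_combination upMon x m * u * (hx.x_mul_pow_eq_zero hrk hFG
        (show rk G ≤ rk F + (a + b + 1) by omega))
  refine ⟨τ * (x G * upSum x G ^ b), ?_, ?_⟩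
  · have e1 : rk ⊤ - 1 - rk G = c := by omega
    have e2 : rk ⊤ - 1 - rk F = a + b + (c + 1) := by omega
    -- Expand x_G h_⊤^c = h_G h_⊤^c - h_⊤^{c+1}. The first term dies by `hkill`; in the second,
    -- h_⊤^{c+1} absorbs h_G^{a+b}.
    have key : upMon x (m + Multiset.replicate a G) * (τ * (x G * upSum x G ^ b)) *
        upSum x ⊤ ^ (rk ⊤ - 1 - rk G) = -(upMon x m * τ * upSum x ⊤ ^ (rk ⊤ - 1 - rk F)) := by
      rw [e1, e2, upMon_add, upMon_replicate, ← hx.pow_mul_top_pow hrk (G := G) (by omega)]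
      have h1 := hx.x_mul_top_pow hrk hG hc
      rw [pow_succ, pow_add] at hkill
      rw [pow_add]
      linear_combination upMon x m * τ * upSum x G ^ a * upSum x G ^ b * h1
        + upSum x ⊤ ^ c * hkill
    rw [key]
    rcases hτ with h | h
    · exact Or.inr (by rw [h])
    · exact Or.inl (by rw [h, neg_neg])
  · intro H hH
    by_cases hHG : H = G
    · subst hHG
      refine ⟨0, ?_, τ * upSum x H ^ b, by simp, by ring⟩
      have : (m + Multiset.replicate a H).countP (fun G => ¬ G ≤ H) = 0 := by
        rw [Multiset.countP_eq_zero]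
        intro K hK
        rw [not_not]
        rcases Multiset.mem_add.1 hK with hK | hK
        · exact (le_of_mem_basisAt hm K hK).trans hFG.le
        · exact (Multiset.eq_of_mem_replicate hK).le
      omega
    · have hHm : H ∈ m := (Multiset.mem_add.1 hH).resolve_right fun h =>
        hHG (Multiset.eq_of_mem_replicate h)
      have hHF := le_of_mem_basisAt hm H hHm
      have hGH : ¬ G ≤ H := fun h => (h.trans hHF).not_gt hFG
      obtain ⟨t, ht, u, hut, rfl⟩ := hu H hHm
      refine ⟨t + (b + 1), ?_, u * (x G * upSum x G ^ b), ?_, by ring⟩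
      · have : (Multiset.replicate a G).countP (fun G => ¬ G ≤ H) = a := by
          rw [Multiset.countP_eq_card.2, Multiset.card_replicate]
          intro K hK
          rwa [Multiset.eq_of_mem_replicate hK]
        rw [Multiset.countP_add, this]
        omega
      · rw [pow_add, pow_succ']
        exact Ideal.mul_mem_mul hut (Ideal.mul_mem_mul (x_mem_upIdeal hGH)
          (Ideal.pow_mem_pow (upSum_mem_upIdeal hGH) b))

lemma test_eq_zero (hrk : IsGeometricRank rk) (hx : FlatRelations rk x) {H : L} (hH : H < ⊤)
    {t s : ℕ} {u : R} (hu : u ∈ upIdeal x H ^ t) (n : Multiset L)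
    (h : rk ⊤ ≤ rk H + (t + s + n.countP (fun G => ¬ G ≤ H))) :
    upMon x n * (x H * u * upSum x ⊤ ^ s) = 0 := by
  have := hx.x_mul_upIdeal_pow hrk hH h (u := u * upSum x ⊤ ^ s * upMon x n) (by
    rw [pow_add, pow_add]
    exact Ideal.mul_mem_mul (Ideal.mul_mem_mul hu
      (Ideal.pow_mem_pow (upSum_mem_upIdeal hH.not_ge) s)) (upMon_mem_upIdeal_pow n H))
  linear_combination this

/-- Strip h_⊤^a off m, test the rest, and multiply by the power of h_⊤ that completes the degree. If
n has fewer factors than m below some H, it has more factors not below H, and with those of τ they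
number at least rk ⊤ - rk H, enough to kill x_H. -/
lemma exists_test (hrk : IsGeometricRank rk) (hx : FlatRelations rk x) {m : Multiset L}
    (hm : m ∈ basis rk) : ∃ τ : R,
      (upMon x m * τ = upSum x ⊤ ^ (rk ⊤ - 1) ∨ upMon x m * τ = -upSum x ⊤ ^ (rk ⊤ - 1)) ∧
      ∀ n : Multiset L, n.card = m.card → upMon x n * τ ≠ 0 →
        ∀ F ∈ m, m.countP (· ≤ F) ≤ n.countP (· ≤ F) := by
  obtain ⟨G, -, hG⟩ := Finset.mem_biUnion.1 hm
  by_cases hbt : (⊥ : L) = ⊤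
  · have hGb : G = ⊥ := le_antisymm (hbt ▸ _root_.le_top) bot_le
    rw [hGb, basisAt_bot, Finset.mem_singleton] at hG
    exact ⟨1, Or.inl (by simp [hG, ← hbt, hrk.bot]), by simp [hG]⟩
  obtain ⟨F, hF, m', a, hm', ha, rfl⟩ : ∃ F < ⊤, ∃ m' a, m' ∈ basisAt rk F ∧ a + rk F < rk ⊤ ∧
      m = m' + Multiset.replicate a ⊤ := by
    by_cases hGt : G = ⊤
    · subst hGt
      obtain ⟨F, hF, a, -, ha, S, hS, rfl⟩ := (mem_basisAt_of_ne (Ne.symm hbt)).1 hG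
      exact ⟨F, hF, S, a, hS, ha, rfl⟩
    · exact ⟨G, lt_top_iff_ne_top.2 hGt, m, 0, hG,
        by simpa using hrk.strictMono (lt_top_iff_ne_top.2 hGt), by simp⟩
  obtain ⟨τ, hτ, hu⟩ := hx.exists_test_of_lt_top hrk hm' hF
  refine ⟨τ * upSum x ⊤ ^ (rk ⊤ - 1 - rk F - a), ?_, ?_⟩
  · have : upMon x (m' + Multiset.replicate a ⊤) * (τ * upSum x ⊤ ^ (rk ⊤ - 1 - rk F - a))
        = upMon x m' * τ * upSum x ⊤ ^ (rk ⊤ - 1 - rk F) := by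
      rw [show rk ⊤ - 1 - rk F = a + (rk ⊤ - 1 - rk F - a) by omega, pow_add, upMon_add,
        upMon_replicate, show a + (rk ⊤ - 1 - rk F - a) - a = rk ⊤ - 1 - rk F - a by omega]
      ring
    rw [this]
    exact hτ
  · intro n hn hne H hH
    by_cases hHt : H = ⊤
    · have : ∀ S : Multiset L, S.countP (· ≤ H) = S.card := fun S =>
        Multiset.countP_eq_card.2 fun G _ => hHt ▸ _root_.le_top
      rw [this, this, hn]
    have hHt' := lt_top_iff_ne_top.2 hHt
    have hHm : H ∈ m' := (Multiset.mem_add.1 hH).resolve_right fun h =>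
      hHt (Multiset.eq_of_mem_replicate h)
    obtain ⟨t, ht, u, hut, rfl⟩ := hu H hHm
    by_contra! hcon
    refine hne (hx.test_eq_zero hrk hHt' hut n ?_)
    have h1 := Multiset.card_eq_countP_add_countP (· ≤ H) n
    have h2 := Multiset.card_eq_countP_add_countP (· ≤ H) (m' + Multiset.replicate a ⊤)
    have h3 : (m' + Multiset.replicate a ⊤).countP (fun G => ¬ G ≤ H)
        = m'.countP (fun G => ¬ G ≤ H) + a := by
      rw [Multiset.countP_add]
      congr 1
      rw [Multiset.countP_eq_card.2, Multiset.card_replicate]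
      intro K hK
      rw [Multiset.eq_of_mem_replicate hK]
      exact hHt'.not_ge
    omega

/-- If no multiple of `h_⊤ ^ (rk ⊤ - 1)` vanishes, then the Feichtner–Yuzvinsky monomials are
linearly independent. -/
theorem linearIndependent_upMon (hrk : IsGeometricRank rk) (hx : FlatRelations rk x)
    (hnt : ∀ c : ℤ, c • upSum x ⊤ ^ (rk ⊤ - 1) = 0 → c = 0) (k : ℕ) :
    LinearIndependent ℤ
      (fun m : {m // m ∈ (basis rk).filter (fun m => m.card = k)} => upMon x m.1) := by
  rw [Fintype.linearIndependent_iff]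
  intro g hg
  by_contra! hne
  obtain ⟨m₁, hm₁⟩ := hne
  -- The test of the monomial of largest total corank annihilates every other monomial of the
  -- relation, by `eq_of_countP_le`.
  obtain ⟨m₀, hm₀, hmax⟩ := (Finset.univ.filter fun m => g m ≠ 0).exists_max_image
    (fun m => corankSum rk m.1) ⟨m₁, by simpa using hm₁⟩
  simp only [Finset.mem_filter, Finset.mem_univ, true_and] at hm₀ hmax
  have hmem := Finset.mem_filter.1 m₀.2
  obtain ⟨τ, hτ, htest⟩ := hx.exists_test hrk hmem.1
  have h0 : ∑ m, g m • (upMon x m.1 * τ) = 0 := by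
    simp_rw [← smul_mul_assoc]
    rw [← Finset.sum_mul, hg, zero_mul]
  rw [Finset.sum_eq_single_of_mem m₀ (Finset.mem_univ _)] at h0
  · rcases hτ with h | h
    · rw [h] at h0
      exact hm₀ (hnt _ h0)
    · rw [h, smul_neg, neg_eq_zero] at h0
      exact hm₀ (hnt _ h0)
  · intro m _ hm
    by_cases hgm : g m = 0
    · rw [hgm, zero_smul]
    by_cases hz : upMon x m.1 * τ = 0
    · rw [hz, smul_zero]
    have hcard : m.1.card = m₀.1.card := (Finset.mem_filter.1 m.2).2.trans hmem.2.symm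
    exact absurd (Subtype.ext (eq_of_countP_le hrk (chain_of_mem_basis hmem.1) hcard
      (htest m.1 hcard hz) (hmax m hgm))) hm

end FlatRelations

end Independence

/-! ### The dragon Hall–Rado functional. -/

section DegreeMap

variable {L : Type*} [Lattice L] [BoundedOrder L] {rk : L → ℕ}

/-- The dragon Hall–Rado condition for a multiset of flats. -/
def DragonHallRado (rk : L → ℕ) (S : Multiset L) : Prop :=
  ∀ J ≤ S, J ≠ 0 → J.card + 1 ≤ rk J.sup

lemma forall_le_cons {α : Type*} {p : Multiset α → Prop} {a : α} {S : Multiset α} :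
    (∀ J ≤ a ::ₘ S, p J) ↔ ∀ J ≤ S, p J ∧ p (a ::ₘ J) := by
  refine ⟨fun h J hJ => ⟨h J (hJ.trans (Multiset.le_cons_self S a)),
    h _ ((Multiset.cons_le_cons_iff a).2 hJ)⟩, fun h J hJ => ?_⟩
  by_cases ha : a ∈ J
  · obtain ⟨J', rfl⟩ := Multiset.exists_cons_of_mem ha
    exact (h J' ((Multiset.cons_le_cons_iff a).1 hJ)).2
  · exact (h J ((Multiset.le_cons_of_notMem ha).1 hJ)).1

/-- Sort the submultisets by which of the two displayed flats they contain. -/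
lemma dragonHallRado_cons_cons (F G : L) (S : Multiset L) :
    DragonHallRado rk (F ::ₘ G ::ₘ S) ↔ DragonHallRado rk S ∧
      (∀ J ≤ S, J.card + 2 ≤ rk (F ⊔ J.sup)) ∧ (∀ J ≤ S, J.card + 2 ≤ rk (G ⊔ J.sup)) ∧
      ∀ J ≤ S, J.card + 3 ≤ rk (F ⊔ G ⊔ J.sup) := by
  simp only [DragonHallRado, forall_le_cons, ← forall_and]
  refine forall_congr' fun J => ?_
  simp only [Multiset.sup_cons, Multiset.card_cons, ne_eq, Multiset.cons_ne_zero, not_false_eq_true,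
    forall_const, sup_assoc]
  tauto

/-- If J₁ violates the condition for F and J₂ the one for G, submodularity applied to F ∨ ⋁J₁ and G
∨ ⋁J₂ contradicts the hypothesis on J₁ ∪ J₂, using `DragonHallRado` for J₁ ∩ J₂ when that is
nonempty. -/
lemma dragonHallRado_dichotomy (hrk : IsGeometricRank rk) {F G : L} {S : Multiset L}
    (hS : DragonHallRado rk S) (h : ∀ J ≤ S, J.card + 3 ≤ rk (F ⊔ G ⊔ J.sup)) :
    (∀ J ≤ S, J.card + 2 ≤ rk (F ⊔ J.sup)) ∨ (∀ J ≤ S, J.card + 2 ≤ rk (G ⊔ J.sup)) := by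
  by_contra! hcon
  obtain ⟨⟨J₁, hJ₁, h₁⟩, J₂, hJ₂, h₂⟩ := hcon
  have hsub := hrk.submod (F ⊔ J₁.sup) (G ⊔ J₂.sup)
  have hU := h (J₁ ∪ J₂) (Multiset.union_le hJ₁ hJ₂)
  have hsup : F ⊔ G ⊔ (J₁ ∪ J₂).sup = F ⊔ J₁.sup ⊔ (G ⊔ J₂.sup) := by
    rw [Multiset.sup_union]
    ac_rfl
  rw [hsup] at hU
  have hcard : (J₁ ∪ J₂).card + (J₁ ∩ J₂).card = J₁.card + J₂.card := by
    rw [← Multiset.card_add, ← Multiset.card_add, Multiset.union_add_inter]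
  have hinf : rk (J₁ ∩ J₂).sup ≤ rk ((F ⊔ J₁.sup) ⊓ (G ⊔ J₂.sup)) := by
    refine hrk.strictMono.monotone (le_inf ?_ ?_)
    · exact (Multiset.sup_mono (Multiset.subset_of_le Multiset.inter_le_left)).trans le_sup_right
    · exact (Multiset.sup_mono (Multiset.subset_of_le Multiset.inter_le_right)).trans le_sup_right
  by_cases h0 : J₁ ∩ J₂ = 0
  · rw [h0, Multiset.card_zero] at hcard
    omega
  · have := hS _ (Multiset.inter_le_left.trans hJ₁) h0
    omega

lemma dragonHallRado_replicate_top :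
    DragonHallRado rk (Multiset.replicate (rk ⊤ - 1) (⊤ : L)) := by
  intro J hJ h0
  obtain ⟨G, hG⟩ := Multiset.exists_mem_of_ne_zero h0
  have hGt : G = ⊤ := Multiset.eq_of_mem_replicate (Multiset.mem_of_le hJ hG)
  have hsup : J.sup = ⊤ := le_antisymm _root_.le_top (hGt ▸ Multiset.le_sup hG)
  have h1 := Multiset.card_le_card hJ
  have h2 := Multiset.card_pos.2 h0
  rw [Multiset.card_replicate] at h1
  rw [hsup]
  omega

/-- The degree map on polynomials in the simplicial generators, extended to all degrees. -/
noncomputable def degreeMap (rk : L → ℕ) : MvPolynomial L ℤ →ₗ[ℤ] ℤ :=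
  (MvPolynomial.basisMonomials L ℤ).constr ℤ
    fun m => if DragonHallRado rk (Finsupp.toMultiset m) then 1 else 0

lemma degreeMap_monomial (m : L →₀ ℕ) :
    degreeMap rk (MvPolynomial.monomial m 1)
      = if DragonHallRado rk (Finsupp.toMultiset m) then 1 else 0 := by
  have : MvPolynomial.monomial m (1 : ℤ) = MvPolynomial.basisMonomials L ℤ m := by
    rw [MvPolynomial.coe_basisMonomials]
  rw [this, degreeMap, Module.Basis.constr_basis]

/-- The relations satisfied by the simplicial generators of the Chow ring. -/
def simplicialRelations (rk : L → ℕ) : Set (MvPolynomial L ℤ) :=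
  {p | (∃ F G : L, p = (MvPolynomial.X F - MvPolynomial.X (F ⊔ G)) *
      (MvPolynomial.X G - MvPolynomial.X (F ⊔ G))) ∨ ∃ A, rk A = 1 ∧ p = MvPolynomial.X A}

lemma degreeMap_monomial_mul_X_mul_X (m : L →₀ ℕ) (F G : L) :
    degreeMap rk (MvPolynomial.monomial m 1 * (MvPolynomial.X F * MvPolynomial.X G))
      = if DragonHallRado rk (F ::ₘ G ::ₘ Finsupp.toMultiset m) then 1 else 0 := by
  rw [MvPolynomial.X, MvPolynomial.X, MvPolynomial.monomial_mul, MvPolynomial.monomial_mul, one_mul,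
    one_mul, degreeMap_monomial]
  simp only [map_add, Finsupp.toMultiset_single, one_smul]
  rw [add_comm, add_assoc, Multiset.singleton_add, Multiset.singleton_add]

/-- It suffices to treat monomials. If S and the condition on F ∨ G hold, the square relation takes
the value (1 - [F])(1 - [G]) in the truth values of the conditions for F and G, which is 0 by the
dichotomy; otherwise all four terms vanish. A single atom already violates the condition. -/
lemma degreeMap_mul_relation (hrk : IsGeometricRank rk) {p : MvPolynomial L ℤ}
    (hp : p ∈ simplicialRelations rk) (q : MvPolynomial L ℤ) : degreeMap rk (q * p) = 0 := by
  induction q using MvPolynomial.induction_on' with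
  | add q q' h h' => rw [add_mul, map_add, h, h', add_zero]
  | monomial m c =>
    have hc : MvPolynomial.monomial m c = c • MvPolynomial.monomial m (1 : ℤ) := by
      rw [MvPolynomial.smul_monomial, smul_eq_mul, mul_one]
    rw [hc, smul_mul_assoc, map_smul]
    suffices degreeMap rk (MvPolynomial.monomial m (1 : ℤ) * p) = 0 by rw [this, smul_zero]
    rcases hp with ⟨F, G, rfl⟩ | ⟨A, hA, rfl⟩
    · have hexp : MvPolynomial.monomial m (1 : ℤ) *
          ((MvPolynomial.X F - MvPolynomial.X (F ⊔ G)) *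
            (MvPolynomial.X G - MvPolynomial.X (F ⊔ G)))
          = MvPolynomial.monomial m 1 * (MvPolynomial.X F * MvPolynomial.X G)
            - MvPolynomial.monomial m 1 * (MvPolynomial.X F * MvPolynomial.X (F ⊔ G))
            - MvPolynomial.monomial m 1 * (MvPolynomial.X (F ⊔ G) * MvPolynomial.X G)
            + MvPolynomial.monomial m 1 *
              (MvPolynomial.X (F ⊔ G) * MvPolynomial.X (F ⊔ G)) := by ring
      rw [hexp, map_add, map_sub, map_sub]
      simp only [degreeMap_monomial_mul_X_mul_X, dragonHallRado_cons_cons]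
      have e1 : F ⊔ (F ⊔ G) = F ⊔ G := by simp
      have e2 : F ⊔ G ⊔ G = F ⊔ G := by simp
      simp only [e1, e2, sup_idem]
      generalize Finsupp.toMultiset m = S
      have himp : (∀ J ≤ S, J.card + 3 ≤ rk (F ⊔ G ⊔ J.sup)) →
          ∀ J ≤ S, J.card + 2 ≤ rk (F ⊔ G ⊔ J.sup) := fun h J hJ => by
        have := h J hJ
        omega
      have hdich := dragonHallRado_dichotomy hrk (F := F) (G := G) (S := S)
      generalize (∀ J ≤ S, J.card + 3 ≤ rk (F ⊔ G ⊔ J.sup)) = Q at *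
      generalize (∀ J ≤ S, J.card + 2 ≤ rk (F ⊔ G ⊔ J.sup)) = P at *
      generalize (∀ J ≤ S, J.card + 2 ≤ rk (F ⊔ J.sup)) = PF at *
      generalize (∀ J ≤ S, J.card + 2 ≤ rk (G ⊔ J.sup)) = PG at *
      by_cases hR : DragonHallRado rk S <;> by_cases hQ : Q <;> by_cases hF : PF <;>
        by_cases hG : PG <;> simp_all
    · rw [MvPolynomial.X, MvPolynomial.monomial_mul, one_mul, degreeMap_monomial, if_neg]
      intro h
      have := h {A} (by simp) (by simp)
      simp [hA] at this

lemma degreeMap_eq_zero (hrk : IsGeometricRank rk) {p : MvPolynomial L ℤ}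
    (hp : p ∈ Ideal.span (simplicialRelations rk)) : degreeMap rk p = 0 := by
  suffices ∀ q, degreeMap rk (q * p) = 0 by simpa using this 1
  induction hp using Submodule.span_induction with
  | mem p hp => exact degreeMap_mul_relation hrk hp
  | zero => simp
  | add p p' _ _ h h' => exact fun q => by rw [mul_add, map_add, h, h', add_zero]
  | smul c p _ h => exact fun q => by rw [smul_eq_mul, ← mul_assoc, h]

end DegreeMap

/-! ### Recovering the x_F from the h_F. -/

section Mobius

variable {L R : Type*} [Lattice L] [BoundedOrder L] [Fintype L] [CommRing R] {rk : L → ℕ}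

/-- Möbius inversion of `upSum`. -/
noncomputable def mobiusInv (h : L → R) (F : L) : R :=
  h F - ∑ G : {G // F < G}, mobiusInv h G.1
termination_by (wellFounded_gt (α := L)).wrap F
decreasing_by exact G.2

lemma upSum_mobiusInv (h : L → R) (F : L) : upSum (mobiusInv h) F = h F := by
  have h1 := FlatRelations.x_eq (mobiusInv h) F
  have h2 : mobiusInv h F = h F - ∑ G with F < G, mobiusInv h G := by
    conv_lhs => rw [mobiusInv]
    rw [← Finset.sum_subtype_eq_sum_filter]
    congr 1
    refine Finset.sum_bij (fun G _ => ⟨G.1, G.2⟩) ?_ ?_ ?_ ?_ <;> simp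
  linear_combination h2 - h1

/-- Converse to `FlatRelations.square`: the expanded square is a sum of x_H x_K over incomparable H
≥ F, K ≥ G, and downward induction on F, then G, removes all terms but x_F x_G. -/
lemma flatRelations_mobiusInv {h : L → R}
    (hsq : ∀ F G, (h F - h (F ⊔ G)) * (h G - h (F ⊔ G)) = 0) (hA : ∀ A, rk A = 1 → h A = 0) :
    FlatRelations rk (mobiusInv h) := by
  refine ⟨?_, fun A hA' => (upSum_mobiusInv h A).trans (hA A hA')⟩
  intro F
  induction F using (wellFounded_gt (α := L)).induction with
  | _ F ihF =>
  intro G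
  induction G using (wellFounded_gt (α := L)).induction with
  | _ G ihG =>
  intro hFG hGF
  have h1 := hsq F G
  rw [← upSum_mobiusInv h F, ← upSum_mobiusInv h G, ← upSum_mobiusInv h (F ⊔ G),
    FlatRelations.upSum_sub, sup_comm, FlatRelations.upSum_sub, Finset.sum_mul_sum,
    Finset.sum_eq_single_of_mem F (by simpa using hGF),
    Finset.sum_eq_single_of_mem G (by simpa using hFG)] at h1
  · exact h1
  · intro K hK hKG
    simp only [Finset.mem_filter, Finset.mem_univ, true_and] at hK
    exact ihG K (lt_of_le_of_ne hK.1 (Ne.symm hKG)) hK.2 fun e => hGF (hK.1.trans e)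
  · intro H hH hHF
    simp only [Finset.mem_filter, Finset.mem_univ, true_and] at hH
    refine Finset.sum_eq_zero fun K hK => ?_
    simp only [Finset.mem_filter, Finset.mem_univ, true_and] at hK
    exact ihF H (lt_of_le_of_ne hH.1 (Ne.symm hHF)) K (fun e => hK.2 (hH.1.trans e))
      fun e => hH.2 (hK.1.trans e)

end Mobius

/-- There is a realization of the relations in which `h_⊤ ^ (rk ⊤ - 1)` has no torsion. -/
theorem exists_flatRelations {L : Type*} [Lattice L] [BoundedOrder L] [Fintype L] {rk : L → ℕ}
    (hrk : IsGeometricRank rk) :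
    ∃ x : L → MvPolynomial L ℤ ⧸ Ideal.span (simplicialRelations rk), FlatRelations rk x ∧
      ∀ c : ℤ, c • upSum x ⊤ ^ (rk ⊤ - 1) = 0 → c = 0 := by
  set I := Ideal.span (simplicialRelations rk) with hI
  let h : L → MvPolynomial L ℤ ⧸ I := fun F => Ideal.Quotient.mk I (MvPolynomial.X F)
  refine ⟨mobiusInv h, flatRelations_mobiusInv ?_ ?_, fun c hc => ?_⟩
  · intro F G
    have : Ideal.Quotient.mk I ((MvPolynomial.X F - MvPolynomial.X (F ⊔ G)) *
        (MvPolynomial.X G - MvPolynomial.X (F ⊔ G))) = 0 :=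
      Ideal.Quotient.eq_zero_iff_mem.2 (Ideal.subset_span (Or.inl ⟨F, G, rfl⟩))
    simpa using this
  · exact fun A hA => Ideal.Quotient.eq_zero_iff_mem.2 (Ideal.subset_span (Or.inr ⟨A, hA, rfl⟩))
  · rw [upSum_mobiusInv] at hc
    have hmem : c • (MvPolynomial.X ⊤ : MvPolynomial L ℤ) ^ (rk ⊤ - 1) ∈ I := by
      rw [← Ideal.Quotient.eq_zero_iff_mem]
      simpa [h] using hc
    have h0 := degreeMap_eq_zero hrk hmem
    rw [MvPolynomial.X_pow_eq_monomial, map_smul, degreeMap_monomial, Finsupp.toMultiset_single,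
      Multiset.nsmul_singleton, if_pos dragonHallRado_replicate_top] at h0
    simpa using h0

/-! ### Generating polynomials in terms of Whitney and flag Whitney numbers. -/

section Counting

variable {L : Type*} [Lattice L] [BoundedOrder L] [Fintype L] {rk : L → ℕ}

lemma basisAt_unique {F G : L} {S : Multiset L} (hF : S ∈ basisAt rk F) (hG : S ∈ basisAt rk G) :
    F = G := by
  rcases eq_bot_or_mem hF with ⟨h1, h2⟩ | h1 <;> rcases eq_bot_or_mem hG with ⟨h3, h4⟩ | h3
  · rw [h1, h3]
  · simp [h2] at h3
  · simp [h4] at h1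
  · exact le_antisymm (le_of_mem_basisAt hG F h1) (le_of_mem_basisAt hF G h3)

/-- The generating polynomial of the Feichtner–Yuzvinsky monomials with largest flat `G`. -/
noncomputable def genAt (rk : L → ℕ) (G : L) : ℤ[X] :=
  ∑ S ∈ basisAt rk G, Polynomial.X ^ S.card

/-- The generating polynomial of the Feichtner–Yuzvinsky monomials. -/
noncomputable def basisGen (rk : L → ℕ) : ℤ[X] := ∑ S ∈ basis rk, Polynomial.X ^ S.card

lemma genAt_bot : genAt rk (⊥ : L) = 1 := by
  simp [genAt, basisAt_bot]

/-- The unions in `basisAt` are disjoint: the exponent a is the multiplicity of G, and the remaining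
monomial determines its own largest flat. -/
lemma genAt_of_ne {G : L} (hG : G ≠ ⊥) :
    genAt rk G = ∑ F with F < G,
      (∑ a ∈ Finset.Ico 1 (rk G - rk F), (Polynomial.X : ℤ[X]) ^ a) * genAt rk F := by
  have hcount : ∀ F < G, ∀ S ∈ basisAt rk F, ∀ a : ℕ, (S + Multiset.replicate a G).count G = a := by
    intro F hF S hS a
    rw [Multiset.count_add, Multiset.count_replicate_self, Multiset.count_eq_zero_of_notMem, zero_add]
    exact fun h => (le_of_mem_basisAt hS G h).not_gt hF
  have hinj : ∀ F < G, ∀ F' < G, ∀ S ∈ basisAt rk F, ∀ S' ∈ basisAt rk F', ∀ a a' : ℕ,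
      S + Multiset.replicate a G = S' + Multiset.replicate a' G → a = a' ∧ S = S' := by
    intro F hF F' hF' S hS S' hS' a a' h
    have ha : a = a' := by rw [← hcount F hF S hS a, h, hcount F' hF' S' hS']
    subst ha
    exact ⟨rfl, add_right_cancel h⟩
  rw [genAt, basisAt, if_neg hG, Finset.sum_biUnion]
  · rw [Finset.sum_attach (Finset.univ.filter (· < G)) fun F =>
      ∑ S ∈ (Finset.Ico 1 (rk G - rk F)).biUnion fun a =>
        (basisAt rk F).image (· + Multiset.replicate a G), (Polynomial.X : ℤ[X]) ^ S.card]
    refine Finset.sum_congr rfl fun F hF => ?_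
    have hFG : F < G := (Finset.mem_filter.1 hF).2
    rw [Finset.sum_biUnion, Finset.sum_mul]
    · refine Finset.sum_congr rfl fun a _ => ?_
      rw [Finset.sum_image (fun S _ S' _ h => add_right_cancel h), genAt, Finset.mul_sum]
      refine Finset.sum_congr rfl fun S _ => ?_
      rw [Multiset.card_add, Multiset.card_replicate, add_comm, pow_add]
    · intro a _ b _ hab
      refine Finset.disjoint_left.2 fun S hS hS' => hab ?_
      obtain ⟨S₁, h₁, rfl⟩ := Finset.mem_image.1 hS
      obtain ⟨S₂, h₂, h⟩ := Finset.mem_image.1 hS'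
      exact ((hinj F hFG F hFG S₂ h₂ S₁ h₁ b a h).1).symm
  · intro F _ F' _ hFF'
    refine Finset.disjoint_left.2 fun S hS hS' => hFF' ?_
    simp only [Finset.mem_biUnion, Finset.mem_image] at hS hS'
    obtain ⟨a, -, S₁, h₁, rfl⟩ := hS
    obtain ⟨b, -, S₂, h₂, h⟩ := hS'
    have := (hinj F'.1 (Finset.mem_filter.1 F'.2).2 F.1 (Finset.mem_filter.1 F.2).2 S₂ h₂ S₁ h₁ b a
      h).2
    subst this
    exact Subtype.ext (basisAt_unique h₁ h₂)

lemma basisGen_eq_sum : basisGen rk = ∑ G : L, genAt rk G := by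
  rw [basisGen, basis, Finset.sum_biUnion]
  · rfl
  · intro F _ G _ hFG
    exact Finset.disjoint_left.2 fun S hS hS' => hFG (basisAt_unique hS hS')

/-- Split off the power of h_⊤; exponent 0 accounts for the monomials not involving ⊤. -/
lemma basisGen_eq (hrk : IsGeometricRank rk) (h : 0 < rk (⊤ : L)) :
    basisGen rk = ∑ F : L, (∑ a ∈ Finset.range (rk ⊤ - rk F), (Polynomial.X : ℤ[X]) ^ a) *
      genAt rk F := by
  have hne : (⊤ : L) ≠ ⊥ := fun e => by
    rw [e, hrk.bot] at h
    omega
  have hsplit : ∀ f : L → ℤ[X], ∑ F, f F = f ⊤ + ∑ F with F < ⊤, f F := by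
    intro f
    have : (Finset.univ : Finset L) = insert ⊤ (Finset.univ.filter fun F => F < ⊤) := by
      ext a
      simp [← le_iff_eq_or_lt]
    conv_lhs => rw [this, Finset.sum_insert (by simp)]
  rw [basisGen_eq_sum, hsplit, hsplit, genAt_of_ne hne, ← Finset.sum_add_distrib]
  simp only [Nat.sub_self, Finset.range_zero, Finset.sum_empty, zero_mul, zero_add]
  refine Finset.sum_congr rfl fun F hF => ?_
  have hF' : rk F < rk ⊤ := hrk.strictMono (Finset.mem_filter.1 hF).2
  rw [Finset.range_eq_Ico, Finset.sum_eq_sum_Ico_succ_bot (show 0 < rk ⊤ - rk F by omega),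
    add_mul, zero_add]
  ring

/-- The number of flats of rank `j`. -/
noncomputable def whitney (rk : L → ℕ) (j : ℕ) : ℕ := (Finset.univ.filter fun F => rk F = j).card

/-- The number of flats of rank `i` below `G`. -/
noncomputable def whitneyBelow (rk : L → ℕ) (i : ℕ) (G : L) : ℕ :=
  (Finset.univ.filter fun F => F ≤ G ∧ rk F = i).card

/-- The number of flags of flats of ranks `i` and `j`. -/
noncomputable def flagWhitney (rk : L → ℕ) (i j : ℕ) : ℕ :=
  ∑ G with rk G = j, whitneyBelow rk i G

lemma sum_lt_eq (hrk : IsGeometricRank rk) (G : L) (f : L → ℤ[X]) :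
    ∑ F with F < G, f F = ∑ j ∈ Finset.range (rk G), ∑ F with F ≤ G ∧ rk F = j, f F := by
  rw [← Finset.sum_fiberwise_of_maps_to (g := rk) (t := Finset.range (rk G))]
  · refine Finset.sum_congr rfl fun j hj => Finset.sum_congr ?_ fun _ _ => rfl
    ext F
    simp only [Finset.mem_filter, Finset.mem_univ, true_and]
    refine ⟨fun h => ⟨h.1.le, h.2⟩, fun h => ⟨lt_of_le_of_ne h.1 fun e => ?_, h.2⟩⟩
    rw [Finset.mem_range, ← h.2, e] at hj
    omega
  · intro F hF
    exact Finset.mem_range.2 (hrk.strictMono (Finset.mem_filter.1 hF).2)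

lemma sum_below_const {i : ℕ} {G : L} {f : L → ℤ[X]} (c : ℤ[X]) (h : ∀ F, rk F = i → f F = c) :
    ∑ F with F ≤ G ∧ rk F = i, f F = (whitneyBelow rk i G : ℤ[X]) * c := by
  rw [Finset.sum_congr rfl fun F hF => h F (Finset.mem_filter.1 hF).2.2, Finset.sum_const,
    nsmul_eq_mul, whitneyBelow]

lemma sum_rank_const {i : ℕ} {f : L → ℤ[X]} (c : ℤ[X]) (h : ∀ F, rk F = i → f F = c) :
    ∑ F with rk F = i, f F = (whitney rk i : ℤ[X]) * c := by
  rw [Finset.sum_congr rfl fun F hF => h F (Finset.mem_filter.1 hF).2, Finset.sum_const,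
    nsmul_eq_mul, whitney]

lemma eq_bot_of_rank (hrk : IsGeometricRank rk) {F : L} (h : rk F = 0) : F = ⊥ :=
  (hrk.eq_of_le bot_le (by omega)).symm

lemma whitneyBelow_zero (hrk : IsGeometricRank rk) (G : L) : whitneyBelow rk 0 G = 1 := by
  rw [whitneyBelow, Finset.card_eq_one]
  refine ⟨⊥, ?_⟩
  ext F
  simp only [Finset.mem_filter, Finset.mem_univ, true_and, Finset.mem_singleton]
  exact ⟨fun h => eq_bot_of_rank hrk h.2, fun h => by simp [h, hrk.bot]⟩

lemma whitneyBelow_top (i : ℕ) : whitneyBelow rk i (⊤ : L) = whitney rk i := by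
  simp [whitneyBelow, whitney]

lemma whitney_zero (hrk : IsGeometricRank rk) : whitney rk 0 = 1 := by
  rw [← whitneyBelow_top, whitneyBelow_zero hrk]

lemma genAt_eq (hrk : IsGeometricRank rk) {n : ℕ} {G : L} (hG : rk G = n + 1) :
    genAt rk G = ∑ j ∈ Finset.range (n + 1), (∑ a ∈ Finset.Ico 1 (n + 1 - j),
      (Polynomial.X : ℤ[X]) ^ a) * ∑ F with F ≤ G ∧ rk F = j, genAt rk F := by
  have hne : G ≠ ⊥ := fun e => by
    rw [e, hrk.bot] at hG
    omega
  rw [genAt_of_ne hne, sum_lt_eq hrk, hG]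
  refine Finset.sum_congr rfl fun j _ => ?_
  rw [Finset.mul_sum]
  exact Finset.sum_congr rfl fun F hF => by rw [(Finset.mem_filter.1 hF).2.2]

lemma genAt_rank_zero (hrk : IsGeometricRank rk) {G : L} (hG : rk G = 0) : genAt rk G = 1 := by
  rw [eq_bot_of_rank hrk hG, genAt_bot]

lemma genAt_rank_one (hrk : IsGeometricRank rk) {G : L} (hG : rk G = 1) : genAt rk G = 0 := by
  simp [genAt_eq hrk hG]

lemma genAt_rank_two (hrk : IsGeometricRank rk) {G : L} (hG : rk G = 2) :
    genAt rk G = Polynomial.X := by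
  rw [genAt_eq hrk hG]
  simp [Finset.sum_range_succ, sum_below_const _ fun F => genAt_rank_zero hrk (G := F),
    whitneyBelow_zero hrk]

lemma genAt_rank_three (hrk : IsGeometricRank rk) {G : L} (hG : rk G = 3) :
    genAt rk G = Polynomial.X + Polynomial.X ^ 2 := by
  rw [genAt_eq hrk hG]
  simp [Finset.sum_range_succ, Finset.sum_Ico_succ_top,
    sum_below_const _ fun F => genAt_rank_zero hrk (G := F),
    sum_below_const _ fun F => genAt_rank_one hrk (G := F), whitneyBelow_zero hrk]

/-- Consecutive ranks in the chain differ by at least 2, so besides powers of h_G only h_F h_G with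
rk F = 2 occurs. -/
lemma genAt_rank_four (hrk : IsGeometricRank rk) {G : L} (hG : rk G = 4) :
    genAt rk G = Polynomial.X + Polynomial.X ^ 2 + Polynomial.X ^ 3 +
      (whitneyBelow rk 2 G : ℤ[X]) * Polynomial.X ^ 2 := by
  rw [genAt_eq hrk hG]
  simp only [Finset.sum_range_succ, Finset.range_zero, Finset.sum_empty,
    sum_below_const _ fun F => genAt_rank_zero hrk (G := F),
    sum_below_const _ fun F => genAt_rank_one hrk (G := F),
    sum_below_const _ fun F => genAt_rank_two hrk (G := F), whitneyBelow_zero hrk]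
  simp [Finset.sum_Ico_succ_top]
  ring

lemma genAt_rank_five (hrk : IsGeometricRank rk) {G : L} (hG : rk G = 5) :
    genAt rk G = Polynomial.X + Polynomial.X ^ 2 + Polynomial.X ^ 3 + Polynomial.X ^ 4 +
      ((whitneyBelow rk 2 G : ℤ[X]) + (whitneyBelow rk 3 G : ℤ[X])) *
        (Polynomial.X ^ 2 + Polynomial.X ^ 3) := by
  rw [genAt_eq hrk hG]
  simp only [Finset.sum_range_succ, Finset.range_zero, Finset.sum_empty,
    sum_below_const _ fun F => genAt_rank_zero hrk (G := F),
    sum_below_const _ fun F => genAt_rank_one hrk (G := F),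
    sum_below_const _ fun F => genAt_rank_two hrk (G := F),
    sum_below_const _ fun F => genAt_rank_three hrk (G := F), whitneyBelow_zero hrk]
  simp [Finset.sum_Ico_succ_top]
  ring

lemma sum_genAt_rank_four (hrk : IsGeometricRank rk) :
    ∑ G : L with rk G = 4, genAt rk G = (whitney rk 4 : ℤ[X]) *
      (Polynomial.X + Polynomial.X ^ 2 + Polynomial.X ^ 3) +
        (flagWhitney rk 2 4 : ℤ[X]) * Polynomial.X ^ 2 := by
  rw [Finset.sum_congr rfl fun G hG => genAt_rank_four hrk (Finset.mem_filter.1 hG).2,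
    Finset.sum_add_distrib, Finset.sum_const, ← Finset.sum_mul, flagWhitney, whitney, nsmul_eq_mul,
    Nat.cast_sum]

lemma sum_genAt_rank_five (hrk : IsGeometricRank rk) :
    ∑ G : L with rk G = 5, genAt rk G = (whitney rk 5 : ℤ[X]) *
      (Polynomial.X + Polynomial.X ^ 2 + Polynomial.X ^ 3 + Polynomial.X ^ 4) +
        ((flagWhitney rk 2 5 : ℤ[X]) + (flagWhitney rk 3 5 : ℤ[X])) *
          (Polynomial.X ^ 2 + Polynomial.X ^ 3) := by
  rw [Finset.sum_congr rfl fun G hG => genAt_rank_five hrk (Finset.mem_filter.1 hG).2,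
    Finset.sum_add_distrib, Finset.sum_const, ← Finset.sum_mul, Finset.sum_add_distrib, flagWhitney,
    flagWhitney, whitney, nsmul_eq_mul, Nat.cast_sum, Nat.cast_sum]

lemma basisGen_eq_sum_rank (hrk : IsGeometricRank rk) {r : ℕ} (h : rk (⊤ : L) = r) (hr : 0 < r) :
    basisGen rk = ∑ j ∈ Finset.range r, (∑ a ∈ Finset.range (r - j), (Polynomial.X : ℤ[X]) ^ a) *
      ∑ F with rk F = j, genAt rk F := by
  rw [basisGen_eq hrk (h ▸ hr), h,
    ← Finset.sum_fiberwise_of_maps_to (g := rk) (t := Finset.range (r + 1)),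
    Finset.sum_range_succ]
  · rw [Finset.sum_eq_zero (s := Finset.univ.filter fun F => rk F = r), add_zero]
    · refine Finset.sum_congr rfl fun j _ => ?_
      rw [Finset.mul_sum]
      exact Finset.sum_congr rfl fun F hF => by rw [(Finset.mem_filter.1 hF).2]
    · intro F hF
      rw [(Finset.mem_filter.1 hF).2]
      simp
  · intro F _
    have := hrk.le_top F
    exact Finset.mem_range.2 (by omega)

lemma basisGen_rank_zero (hrk : IsGeometricRank rk) (h : rk (⊤ : L) = 0) : basisGen rk = 1 := by
  have hall : ∀ F : L, F = ⊥ := fun F => eq_bot_of_rank hrk (by have := hrk.le_top F; omega)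
  rw [basisGen_eq_sum, Fintype.sum_eq_single ⊥ fun F hF => absurd (hall F) hF, genAt_bot]

lemma basisGen_rank_one (hrk : IsGeometricRank rk) (h : rk (⊤ : L) = 1) : basisGen rk = 1 := by
  rw [basisGen_eq_sum_rank hrk h (by norm_num)]
  simp [sum_rank_const _ fun F => genAt_rank_zero hrk (G := F), whitney_zero hrk]

lemma basisGen_rank_two (hrk : IsGeometricRank rk) (h : rk (⊤ : L) = 2) :
    basisGen rk = 1 + Polynomial.X := by
  rw [basisGen_eq_sum_rank hrk h (by norm_num)]
  simp [Finset.sum_range_succ, sum_rank_const _ fun F => genAt_rank_zero hrk (G := F),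
    sum_rank_const _ fun F => genAt_rank_one hrk (G := F), whitney_zero hrk]

lemma basisGen_rank_three (hrk : IsGeometricRank rk) (h : rk (⊤ : L) = 3) :
    basisGen rk = 1 + ((whitney rk 2 + 1 : ℕ) : ℤ[X]) * Polynomial.X + Polynomial.X ^ 2 := by
  rw [basisGen_eq_sum_rank hrk h (by norm_num)]
  simp [Finset.sum_range_succ, sum_rank_const _ fun F => genAt_rank_zero hrk (G := F),
    sum_rank_const _ fun F => genAt_rank_one hrk (G := F),
    sum_rank_const _ fun F => genAt_rank_two hrk (G := F), whitney_zero hrk]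
  ring

lemma basisGen_rank_four (hrk : IsGeometricRank rk) (h : rk (⊤ : L) = 4) :
    basisGen rk = (1 + Polynomial.X) *
      (1 + ((whitney rk 2 + whitney rk 3 : ℕ) : ℤ[X]) * Polynomial.X + Polynomial.X ^ 2) := by
  rw [basisGen_eq_sum_rank hrk h (by norm_num)]
  simp [Finset.sum_range_succ, sum_rank_const _ fun F => genAt_rank_zero hrk (G := F),
    sum_rank_const _ fun F => genAt_rank_one hrk (G := F),
    sum_rank_const _ fun F => genAt_rank_two hrk (G := F),
    sum_rank_const _ fun F => genAt_rank_three hrk (G := F), whitney_zero hrk]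
  ring

lemma basisGen_rank_five (hrk : IsGeometricRank rk) (h : rk (⊤ : L) = 5) :
    basisGen rk = 1 + ((whitney rk 2 + whitney rk 3 + whitney rk 4 + 1 : ℕ) : ℤ[X]) * Polynomial.X +
      ((1 + whitney rk 2 + 2 * whitney rk 3 + whitney rk 4 + flagWhitney rk 2 4 : ℕ) : ℤ[X]) *
        Polynomial.X ^ 2 +
      ((whitney rk 2 + whitney rk 3 + whitney rk 4 + 1 : ℕ) : ℤ[X]) * Polynomial.X ^ 3 +
      Polynomial.X ^ 4 := by
  rw [basisGen_eq_sum_rank hrk h (by norm_num)]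
  simp [Finset.sum_range_succ, sum_rank_const _ fun F => genAt_rank_zero hrk (G := F),
    sum_rank_const _ fun F => genAt_rank_one hrk (G := F),
    sum_rank_const _ fun F => genAt_rank_two hrk (G := F),
    sum_rank_const _ fun F => genAt_rank_three hrk (G := F), sum_genAt_rank_four hrk,
    whitney_zero hrk]
  ring

lemma basisGen_rank_six (hrk : IsGeometricRank rk) (h : rk (⊤ : L) = 6) :
    basisGen rk = (1 + Polynomial.X) *
      (1 + ((whitney rk 2 + whitney rk 3 + whitney rk 4 + whitney rk 5 : ℕ) : ℤ[X]) *
        Polynomial.X +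
      ((1 + whitney rk 3 + whitney rk 4 + flagWhitney rk 2 4 + flagWhitney rk 2 5 +
        flagWhitney rk 3 5 : ℕ) : ℤ[X]) * Polynomial.X ^ 2 +
      ((whitney rk 2 + whitney rk 3 + whitney rk 4 + whitney rk 5 : ℕ) : ℤ[X]) *
        Polynomial.X ^ 3 + Polynomial.X ^ 4) := by
  rw [basisGen_eq_sum_rank hrk h (by norm_num)]
  simp [Finset.sum_range_succ, sum_rank_const _ fun F => genAt_rank_zero hrk (G := F),
    sum_rank_const _ fun F => genAt_rank_one hrk (G := F),
    sum_rank_const _ fun F => genAt_rank_two hrk (G := F),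
    sum_rank_const _ fun F => genAt_rank_three hrk (G := F), sum_genAt_rank_four hrk,
    sum_genAt_rank_five hrk, whitney_zero hrk]
  ring

lemma whitney_pos (hrk : IsGeometricRank rk) {j : ℕ} (hj : j ≤ rk (⊤ : L)) : 0 < whitney rk j := by
  obtain ⟨K, -, -, hK⟩ := hrk.exists_rank_eq (bot_le : (⊥ : L) ≤ ⊤) (by rw [hrk.bot]; omega) hj
  exact Finset.card_pos.2 ⟨K, by simpa using hK⟩

lemma flagWhitney_le_mul (i j : ℕ) : flagWhitney rk i j ≤ whitney rk i * whitney rk j := by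
  rw [flagWhitney, mul_comm, whitney]
  refine (Finset.sum_le_card_nsmul _ _ (whitney rk i) fun G _ => ?_).trans (smul_eq_mul _ _).le
  exact Finset.card_le_card fun F hF => by
    simpa using (Finset.mem_filter.1 hF).2.2

/-- Strictly inside the ranks of [⊥, G] each level has at least two elements. The dual bound uses
[F, ⊤], hence j < rk ⊤ there. -/
lemma two_mul_whitney_le_right (hrk : IsGeometricRank rk) {i j : ℕ} (hi : 0 < i) (hij : i < j) :
    2 * whitney rk j ≤ flagWhitney rk i j := by
  rw [flagWhitney, mul_comm, whitney, ← smul_eq_mul]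
  refine Finset.card_nsmul_le_sum _ _ 2 fun G hG => ?_
  have hG' : rk G = j := (Finset.mem_filter.1 hG).2
  obtain ⟨K, K', hne, hK, hK'⟩ := hrk.exists_two (bot_le : ⊥ ≤ G) (by rw [hrk.bot]; omega)
    (by omega : i < rk G)
  exact Finset.one_lt_card.2 ⟨K, by simpa using hK, K', by simpa using hK', hne⟩

lemma two_mul_whitney_le_left (hrk : IsGeometricRank rk) {i j : ℕ} (hij : i < j)
    (hj : j < rk (⊤ : L)) : 2 * whitney rk i ≤ flagWhitney rk i j := by
  have hswap : flagWhitney rk i j = ∑ F : L with rk F = i,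
      (Finset.univ.filter fun G => F ≤ G ∧ rk G = j).card := by
    have := Finset.sum_card_bipartiteAbove_eq_sum_card_bipartiteBelow (fun F G : L => F ≤ G)
      (s := Finset.univ.filter fun F => rk F = i) (t := Finset.univ.filter fun G => rk G = j)
    simp only [Finset.bipartiteAbove, Finset.bipartiteBelow, Finset.filter_filter] at this
    rw [flagWhitney]
    simp only [whitneyBelow]
    simp only [and_comm] at this ⊢
    exact this.symm
  rw [hswap, mul_comm, whitney, ← smul_eq_mul]
  refine Finset.card_nsmul_le_sum _ _ 2 fun F hF => ?_
  have hF' : rk F = i := (Finset.mem_filter.1 hF).2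
  obtain ⟨K, K', hne, hK, hK'⟩ := hrk.exists_two (le_top : F ≤ ⊤) (by omega : rk F < j) hj
  exact Finset.one_lt_card.2 ⟨K, by simpa using hK, K', by simpa using hK', hne⟩

end Counting

/-! ### Real-rootedness of palindromic polynomials of small degree. -/

section RealRooted

lemma im_eq_zero_of_quadratic {α : ℝ} (hα : 2 ≤ α) {z : ℂ} (h : 1 + α * z + z ^ 2 = 0) :
    z.im = 0 := by
  have hre := congrArg Complex.re h
  have him := congrArg Complex.im h
  simp [pow_two] at hre him
  by_contra hz
  have h1 : α + 2 * z.re = 0 := by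
    apply mul_right_cancel₀ hz
    linear_combination him
  have h2 : z.re = -α / 2 := by linarith
  have h3 : 0 < z.im * z.im := mul_self_pos.2 hz
  rw [h2] at hre
  nlinarith

/-- Factor as (1 + uz + z²)(1 + vz + z²) with u + v = a, uv = b - 2. The third hypothesis makes u
and v real; the first two make the smaller one at least 2. -/
lemma im_eq_zero_of_quartic {a b : ℝ} (ha : 4 ≤ a) (hab : 2 * a ≤ b + 2) (hab' : 4 * b ≤ a ^ 2 + 8)
    {z : ℂ} (h : 1 + a * z + b * z ^ 2 + a * z ^ 3 + z ^ 4 = 0) : z.im = 0 := by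
  set s := Real.sqrt (a ^ 2 - 4 * (b - 2)) with hs
  have hs2 : s ^ 2 = a ^ 2 - 4 * (b - 2) := Real.sq_sqrt (by linarith)
  have hs0 : 0 ≤ s := Real.sqrt_nonneg _
  have hs1 : s ≤ a - 4 := by
    refine Real.sqrt_le_iff.2 ⟨by linarith, by nlinarith⟩
  have hfac : (1 + ((a + s) / 2 : ℝ) * z + z ^ 2) * (1 + ((a - s) / 2 : ℝ) * z + z ^ 2) = 0 := by
    rw [← h]
    have hs2' : (s : ℂ) ^ 2 = a ^ 2 - 4 * (b - 2) := by exact_mod_cast hs2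
    push_cast
    linear_combination (-1 / 4 * z ^ 2) * hs2'
  rcases mul_eq_zero.1 hfac with h' | h'
  · exact im_eq_zero_of_quadratic (by linarith) h'
  · exact im_eq_zero_of_quadratic (by linarith) h'

lemma realRooted_one : RealRooted 1 := fun z hz => by simp at hz

lemma realRooted_one_add_X : RealRooted (1 + Polynomial.X) := fun z hz => by
  have : z = -1 := by
    simp only [map_add, map_one, Polynomial.aeval_X] at hz
    linear_combination hz
  simp [this]

lemma RealRooted.mul {p q : ℤ[X]} (hp : RealRooted p) (hq : RealRooted q) : RealRooted (p * q) :=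
  fun z hz => by
    rw [map_mul, mul_eq_zero] at hz
    exact hz.elim (hp z) (hq z)

lemma realRooted_quadratic {a : ℕ} (ha : 2 ≤ a) :
    RealRooted (1 + (a : ℤ[X]) * Polynomial.X + Polynomial.X ^ 2) := fun z hz => by
  refine im_eq_zero_of_quadratic (α := a) (by exact_mod_cast ha) ?_
  simpa using hz

lemma realRooted_quartic {a b : ℕ} (ha : 4 ≤ a) (hab : 2 * a ≤ b + 2) (hab' : 4 * b ≤ a ^ 2 + 8) :
    RealRooted (1 + (a : ℤ[X]) * Polynomial.X + (b : ℤ[X]) * Polynomial.X ^ 2 +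
      (a : ℤ[X]) * Polynomial.X ^ 3 + Polynomial.X ^ 4) := fun z hz => by
  refine im_eq_zero_of_quartic (a := a) (b := b) (by exact_mod_cast ha) (by exact_mod_cast hab)
    (by exact_mod_cast hab') ?_
  simpa using hz

variable {L : Type*} [Lattice L] [BoundedOrder L] [Fintype L] {rk : L → ℕ}

/-- The generating polynomial of the Feichtner–Yuzvinsky monomials is real-rooted in rank at
most six. -/
theorem realRooted_basisGen (hrk : IsGeometricRank rk) (h6 : rk (⊤ : L) ≤ 6) :
    RealRooted (basisGen rk) := by
  obtain ⟨r, hr⟩ : ∃ r, rk (⊤ : L) = r := ⟨_, rfl⟩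
  have hpos : ∀ j ≤ r, 0 < whitney rk j := fun j hj => whitney_pos hrk (by omega)
  rw [hr] at h6
  interval_cases r
  · exact basisGen_rank_zero hrk hr ▸ realRooted_one
  · exact basisGen_rank_one hrk hr ▸ realRooted_one
  · exact basisGen_rank_two hrk hr ▸ realRooted_one_add_X
  · rw [basisGen_rank_three hrk hr]
    have := hpos 2 (by norm_num)
    exact realRooted_quadratic (by omega)
  · rw [basisGen_rank_four hrk hr]
    have := hpos 2 (by norm_num)
    have := hpos 3 (by norm_num)
    exact realRooted_one_add_X.mul (realRooted_quadratic (by omega))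
  · rw [basisGen_rank_five hrk hr]
    have h2 := hpos 2 (by norm_num)
    have h3 := hpos 3 (by norm_num)
    have h4 := hpos 4 (by norm_num)
    have e1 := two_mul_whitney_le_right hrk (show 0 < 2 by norm_num) (show 2 < 4 by norm_num)
    have e2 := two_mul_whitney_le_left hrk (show 2 < 4 by norm_num) (by omega)
    have e3 := flagWhitney_le_mul (rk := rk) 2 4
    -- The condition 2a ≤ b + 2 reads W_2 + W_4 ≤ W_{2,4} + 1: average the two lower bounds.
    refine realRooted_quartic (by omega) (by omega) ?_
    generalize whitney rk 2 = p at *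
    generalize whitney rk 3 = q at *
    generalize whitney rk 4 = s at *
    generalize flagWhitney rk 2 4 = w at *
    zify at *
    -- With w replaced by ps, the difference a² + 8 - 4b is (p - s)² + (q - 1)² + 2(q - 1)(p + s -
    -- 2).
    have k1 : (0 : ℤ) ≤ (q - 1) * (p - 1 + (s - 1)) := mul_nonneg (by omega) (by omega)
    nlinarith [sq_nonneg (p - s : ℤ), sq_nonneg (q - 1 : ℤ)]
  · rw [basisGen_rank_six hrk hr]
    have h2 := hpos 2 (by norm_num)
    have h3 := hpos 3 (by norm_num)
    have h4 := hpos 4 (by norm_num)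
    have h5 := hpos 5 (by norm_num)
    have e1 := two_mul_whitney_le_right hrk (show 0 < 2 by norm_num) (show 2 < 4 by norm_num)
    have e2 := two_mul_whitney_le_left hrk (show 2 < 4 by norm_num) (by omega)
    have e3 := flagWhitney_le_mul (rk := rk) 2 4
    have f1 := two_mul_whitney_le_right hrk (show 0 < 2 by norm_num) (show 2 < 5 by norm_num)
    have f2 := two_mul_whitney_le_left hrk (show 2 < 5 by norm_num) (by omega)
    have f3 := flagWhitney_le_mul (rk := rk) 2 5
    have g1 := two_mul_whitney_le_right hrk (show 0 < 3 by norm_num) (show 3 < 5 by norm_num)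
    have g2 := two_mul_whitney_le_left hrk (show 3 < 5 by norm_num) (by omega)
    have g3 := flagWhitney_le_mul (rk := rk) 3 5
    -- Here 2a ≤ b + 2 follows by adding W_{i,j} ≥ W_i + W_j over the three pairs (2,4), (2,5),
    -- (3,5).
    refine realRooted_one_add_X.mul (realRooted_quartic (by omega) (by omega) ?_)
    generalize whitney rk 2 = p at *
    generalize whitney rk 3 = q at *
    generalize whitney rk 4 = s at *
    generalize whitney rk 5 = t at *
    generalize flagWhitney rk 2 4 = w at *
    generalize flagWhitney rk 2 5 = w' at *
    generalize flagWhitney rk 3 5 = w'' at *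
    zify at *
    -- With the flag numbers at their upper bounds, a² + 8 - 4b is (p + q - s - t)² + 4(q - 1)(s -
    -- 1).
    have k1 : (0 : ℤ) ≤ (q - 1) * (s - 1) := mul_nonneg (by omega) (by omega)
    nlinarith [sq_nonneg (p + q - s - t : ℤ)]

end RealRooted

/-! ### The geometric lattice of flats of a matroid. -/

section Flats

variable {α : Type*}

/-- The type of flats of a matroid. -/
abbrev Flat (M : Matroid α) : Type _ := {F : Set α // M.IsFlat F}

namespace Flat

variable {M : Matroid α}

lemma closure_subset_flat (G : Flat M) {X : Set α} (h : X ⊆ G.1) : M.closure X ⊆ G.1 :=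
  (M.closure_subset_closure h).trans G.2.closure.subset

noncomputable instance : Lattice (Flat M) :=
  { (inferInstance : PartialOrder (Flat M)) with
    sup := fun F G => ⟨M.closure (F.1 ∪ G.1), M.isFlat_closure _⟩
    le_sup_left := fun F G => Set.subset_union_left.trans
      (M.subset_closure _ (Set.union_subset F.2.subset_ground G.2.subset_ground))
    le_sup_right := fun F G => Set.subset_union_right.trans
      (M.subset_closure _ (Set.union_subset F.2.subset_ground G.2.subset_ground))
    sup_le := fun _ _ K h h' => closure_subset_flat K (Set.union_subset h h')
    inf := fun F G => ⟨F.1 ∩ G.1, by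
      have := Matroid.IsFlat.iInter (M := M) (Fs := fun b : Bool => cond b F.1 G.1)
        (by rintro (_ | _) <;> simp [F.2, G.2])
      rwa [← Set.inter_eq_iInter] at this⟩
    inf_le_left := fun _ _ => Set.inter_subset_left
    inf_le_right := fun _ _ => Set.inter_subset_right
    le_inf := fun _ _ _ h h' => Set.subset_inter h h' }

instance : BoundedOrder (Flat M) where
  top := ⟨M.E, M.ground_isFlat⟩
  le_top F := F.2.subset_ground
  bot := ⟨M.closure ∅, M.isFlat_closure _⟩
  bot_le F := closure_subset_flat F (Set.empty_subset _)

noncomputable instance [M.Finite] : Fintype (Flat M) := by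
  have : Finite (Flat M) :=
    (M.ground_finite.finite_subsets.subset fun F (hF : M.IsFlat F) => hF.subset_ground).to_subtype
  exact Fintype.ofFinite _

lemma val_bot : (⊥ : Flat M).1 = M.closure ∅ := rfl

lemma val_top : (⊤ : Flat M).1 = M.E := rfl

lemma val_sup (F G : Flat M) : (F ⊔ G).1 = M.closure (F.1 ∪ G.1) := rfl

lemma val_inf (F G : Flat M) : (F ⊓ G).1 = F.1 ∩ G.1 := rfl

lemma le_iff {F G : Flat M} : F ≤ G ↔ F.1 ⊆ G.1 := Iff.rfl

/-- The rank of a flat as a natural number. -/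
noncomputable def rank (F : Flat M) : ℕ := (M.eRk F.1).toNat

lemma cast_rank [M.Finite] (F : Flat M) : (F.rank : ℕ∞) = M.eRk F.1 :=
  ENat.natCast_toNat (M.isRkFinite_set F.1).eRk_lt_top.ne

lemma isGeometricRank (M : Matroid α) [M.Finite] [M.Loopless] :
    IsGeometricRank (rank : Flat M → ℕ) where
  bot := by simp [rank, val_bot]
  strictMono F G h := by
    have hle : M.eRk F.1 ≤ M.eRk G.1 := M.eRk_mono h.le
    rw [← Nat.cast_lt (α := ℕ∞), cast_rank, cast_rank]
    refine lt_of_le_of_ne hle fun e => h.ne ?_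
    have := (M.isRkFinite_set F.1).closure_eq_closure_of_subset_of_eRk_ge_eRk h.le e.ge
    exact Subtype.ext (by rwa [F.2.closure, G.2.closure] at this)
  submod F G := by
    have := M.eRk_inter_add_eRk_union_le F.1 G.1
    rw [← Nat.cast_le (α := ℕ∞), Nat.cast_add, Nat.cast_add, cast_rank, cast_rank, cast_rank,
      cast_rank, val_sup, val_inf, Matroid.eRk_closure_eq, add_comm]
    exact this
  exists_atom F G h := by
    obtain ⟨e, heG, heF⟩ := Set.exists_of_ssubset (Set.ssubset_iff_subset_ne.2
      ⟨h.le, fun e => h.ne (Subtype.ext e)⟩)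
    have heE : e ∈ M.E := G.2.subset_ground heG
    refine ⟨⟨M.closure {e}, M.isFlat_closure _⟩, ?_, closure_subset_flat G (by simpa using heG),
      fun h => heF (h (M.mem_closure_self e heE))⟩
    simp [rank, M.eRk_singleton_eq heE]

end Flat

end Flats

/-! ### Transfer to the Chow ring of the matroid. -/

section ChowRing

variable {α : Type*} {M : Matroid α}

lemma mem_maxBuildingSet {F : Set α} : F ∈ maxBuildingSet M ↔ ∃ G : Flat M, G ≠ ⊥ ∧ G.1 = F := by
  constructor
  · exact fun h => ⟨⟨F, h.1⟩, fun e => h.2 (congrArg Subtype.val e), rfl⟩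
  · rintro ⟨G, hG, rfl⟩
    exact ⟨G.2, fun e => hG (Subtype.ext e)⟩

/-- The flat underlying an element of the maximal building set. -/
def buildFlat (G : maxBuildingSet M) : Flat M := ⟨G.1, G.2.1⟩

lemma buildFlat_ne_bot (G : maxBuildingSet M) : buildFlat G ≠ ⊥ :=
  fun e => G.2.2 (congrArg Subtype.val e)

lemma buildFlat_injective : Function.Injective (buildFlat (M := M)) :=
  fun _ _ h => Subtype.ext (congrArg (fun F : Flat M => F.1) h)

lemma exists_buildFlat {F : Flat M} (hF : F ≠ ⊥) : ∃ G, buildFlat G = F :=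
  ⟨⟨F.1, mem_maxBuildingSet.2 ⟨F, hF, rfl⟩⟩, rfl⟩

/-- The Chow ring generator of a flat, with `0` in place of a generator for the least flat. -/
noncomputable def chowGen (M : Matroid α) (F : Flat M) : ChowRing M (maxBuildingSet M) :=
  if h : F ≠ ⊥ then Ideal.Quotient.mk _
    (MvPolynomial.X (⟨F.1, mem_maxBuildingSet.2 ⟨F, h, rfl⟩⟩ : maxBuildingSet M)) else 0

lemma chowGen_bot : chowGen M ⊥ = 0 := by simp [chowGen]

lemma chowGen_buildFlat (G : maxBuildingSet M) :
    chowGen M (buildFlat G) = Ideal.Quotient.mk _ (MvPolynomial.X G) := by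
  rw [chowGen, dif_pos (buildFlat_ne_bot G)]
  rfl

lemma exists_incomparable_of_not_isNested {S : Set (maxBuildingSet M)}
    (hS : ¬ IsNested M (maxBuildingSet M) (Subtype.val '' S)) :
    ∃ F ∈ S, ∃ G ∈ S, ¬ buildFlat F ≤ buildFlat G ∧ ¬ buildFlat G ≤ buildFlat F := by
  simp only [IsNested, not_and, not_forall] at hS
  obtain ⟨A, hA, ⟨F, hF, G, hG, hFG⟩, hanti, -⟩ := hS (by rintro _ ⟨F, -, rfl⟩; exact F.2)
  obtain ⟨F, hFS, rfl⟩ := hA hF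
  obtain ⟨G, hGS, rfl⟩ := hA hG
  exact ⟨F, hFS, G, hGS, hanti hF hG hFG, hanti hG hF hFG.symm⟩

/-- The join of two incomparable flats is again a flat other than ⊥, so it lies in the maximal
building set. -/
lemma not_isNested_pair {F G : maxBuildingSet M} (h : ¬ buildFlat F ≤ buildFlat G)
    (h' : ¬ buildFlat G ≤ buildFlat F) :
    ¬ IsNested M (maxBuildingSet M) (Subtype.val '' (({F, G} : Finset (maxBuildingSet M)) :
      Set (maxBuildingSet M))) := by
  intro hN
  refine hN.2 {F.1, G.1} ?_ ?_ ?_ ⟨M.isFlat_closure _, fun e => h ?_⟩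
  · rintro _ (rfl | rfl)
    · exact ⟨F, by simp, rfl⟩
    · exact ⟨G, by simp, rfl⟩
  · exact ⟨F.1, by simp, G.1, by simp, fun e => h (Flat.le_iff.2 e.subset)⟩
  · rintro _ (rfl | rfl) _ (rfl | rfl) hne
    · exact absurd rfl hne
    · exact h
    · exact h'
    · exact absurd rfl hne
  · have : F.1 ⊆ M.closure ∅ := by
      rw [← e]
      refine Set.Subset.trans ?_ (M.subset_closure _ ?_)
      · exact Set.subset_sUnion_of_mem (by simp)
      · refine Set.sUnion_subset ?_
        rintro _ (rfl | rfl)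
        · exact F.2.1.subset_ground
        · exact G.2.1.subset_ground
    exact this.trans (bot_le (a := buildFlat G))

variable [M.Finite]

noncomputable instance : Fintype (maxBuildingSet M) :=
  Fintype.ofInjective buildFlat buildFlat_injective

/-- The building set omits only ⊥, which contains no atom. -/
lemma sum_buildFlat {R : Type*} [CommRing R] {A : Flat M} (hA : A.rank = 1) (y : Flat M → R) :
    ∑ G : maxBuildingSet M, (if A.1 ⊆ G.1 then y (buildFlat G) else 0) =
      ∑ G : Flat M with A ≤ G, y G := by
  rw [Finset.sum_filter]
  refine Fintype.sum_of_injective buildFlat buildFlat_injective _ _ ?_ fun _ => rfl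
  intro F hF
  refine if_neg fun hAF => hF ?_
  refine exists_buildFlat fun e => ?_
  subst e
  rw [le_bot_iff.1 hAF] at hA
  simp [Flat.rank, Flat.val_bot] at hA

lemma finsum_atom (A : Set α) :
    (∑ᶠ (G : maxBuildingSet M) (_ : A ⊆ (G : Set α)), MvPolynomial.X G :
      MvPolynomial (maxBuildingSet M) ℤ) =
      ∑ G : maxBuildingSet M, if A ⊆ G.1 then MvPolynomial.X G else 0 := by
  rw [finsum_eq_sum_of_fintype]
  exact Finset.sum_congr rfl fun G _ => finsum_eq_if

lemma flatRelations_chowGen (M : Matroid α) [M.Finite] :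
    FlatRelations (Flat.rank : Flat M → ℕ) (chowGen M) where
  mul_eq_zero F G hFG hGF := by
    obtain ⟨F, rfl⟩ := exists_buildFlat (F := F) fun e => hFG (e ▸ bot_le)
    obtain ⟨G, rfl⟩ := exists_buildFlat (F := G) fun e => hGF (e ▸ bot_le)
    rw [chowGen_buildFlat, chowGen_buildFlat, ← map_mul, Ideal.Quotient.eq_zero_iff_mem]
    refine Ideal.subset_span (Or.inl ⟨{F, G}, not_isNested_pair hFG hGF, ?_⟩)
    exact (Finset.prod_pair fun e => hFG (by rw [e])).symm
  atom_sum A hA := by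
    rw [← sum_buildFlat hA]
    have hmem : (∑ G : maxBuildingSet M, if A.1 ⊆ G.1 then MvPolynomial.X G else 0 :
        MvPolynomial (maxBuildingSet M) ℤ) ∈ chowIdeal M (maxBuildingSet M) := by
      refine Ideal.subset_span (Or.inr ⟨A.1, A.2, ?_, (finsum_atom A.1).symm⟩)
      rw [← Flat.cast_rank, hA, Nat.cast_one]
    rw [← Ideal.Quotient.eq_zero_iff_mem, map_sum] at hmem
    refine Eq.trans ?_ hmem
    refine Finset.sum_congr rfl fun G _ => ?_
    rw [chowGen_buildFlat, apply_ite (Ideal.Quotient.mk _), map_zero]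

/-- Universal property of the Chow ring; ⊥ is excluded because it carries no generator, so y ⊥ is
unconstrained by the map. -/
lemma exists_lift {R : Type*} [CommRing R] {y : Flat M → R}
    (hy : FlatRelations (Flat.rank : Flat M → ℕ) y) :
    ∃ φ : ChowRing M (maxBuildingSet M) →+* R, ∀ F, F ≠ ⊥ → φ (chowGen M F) = y F := by
  let ψ : MvPolynomial (maxBuildingSet M) ℤ →+* R :=
    (MvPolynomial.aeval fun G => y (buildFlat G) : _ →ₐ[ℤ] R).toRingHom
  have hψ : ∀ G, ψ (MvPolynomial.X G) = y (buildFlat G) := fun G => MvPolynomial.aeval_X _ G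
  have hker : chowIdeal M (maxBuildingSet M) ≤ RingHom.ker ψ := by
    refine Ideal.span_le.2 ?_
    rintro p (⟨S, hS, rfl⟩ | ⟨A, hA, hA', rfl⟩)
    · obtain ⟨F, hF, G, hG, hFG, hGF⟩ := exists_incomparable_of_not_isNested hS
      have hG' : G ∈ S.erase F := Finset.mem_erase.2 ⟨fun e => hFG (e ▸ le_rfl), hG⟩
      rw [SetLike.mem_coe, RingHom.mem_ker, map_prod, ← Finset.mul_prod_erase S _ hF,
        ← Finset.mul_prod_erase _ _ hG', hψ, hψ, ← mul_assoc, hy.mul_eq_zero _ _ hFG hGF, zero_mul]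
    · have hr : Flat.rank (⟨A, hA⟩ : Flat M) = 1 := by simp [Flat.rank, hA']
      rw [SetLike.mem_coe, RingHom.mem_ker, finsum_atom, map_sum, ← hy.atom_sum ⟨A, hA⟩ hr,
        ← sum_buildFlat hr]
      refine Finset.sum_congr rfl fun G _ => ?_
      rw [apply_ite ψ, hψ, map_zero]
  refine ⟨Ideal.Quotient.lift _ ψ fun p hp => RingHom.mem_ker.1 (hker hp), fun F hF => ?_⟩
  obtain ⟨G, rfl⟩ := exists_buildFlat hF
  rw [chowGen_buildFlat, Ideal.Quotient.lift_mk, hψ]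

lemma smul_top_pow_ne_zero (M : Matroid α) [M.Finite] [M.Loopless] (c : ℤ)
    (hc : c • upSum (chowGen M) ⊤ ^ (Flat.rank (⊤ : Flat M) - 1) = 0) : c = 0 := by
  obtain ⟨y, hy, hnt⟩ := exists_flatRelations (Flat.isGeometricRank M)
  obtain ⟨φ, hφ⟩ := exists_lift hy
  refine hnt c ?_
  have h := congrArg φ hc
  rw [map_zsmul, map_pow, map_zero] at h
  -- In rank 0 the truncated exponent is 0 and the power is 1.
  by_cases hbt : (⊤ : Flat M) = ⊥
  · rw [hbt, (Flat.isGeometricRank M).bot] at h ⊢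
    simpa using h
  · rwa [FlatRelations.upSum_top, hφ _ hbt, ← FlatRelations.upSum_top y] at h

/-- The span of the monomials of degree `k` in the simplicial generators. -/
noncomputable def upSpan (M : Matroid α) [M.Finite] (k : ℕ) : Submodule ℤ (ChowRing M (maxBuildingSet M)) :=
  Submodule.span ℤ (upMon (chowGen M) '' {S | ⊥ ∉ S ∧ S.card = k})

lemma mul_mem_upSpan {a b : ℕ} {u v : ChowRing M (maxBuildingSet M)} (hu : u ∈ upSpan M a)
    (hv : v ∈ upSpan M b) : u * v ∈ upSpan M (a + b) := by
  have h := Submodule.mul_mem_mul hu hv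
  rw [upSpan, upSpan, Submodule.span_mul_span] at h
  refine Submodule.span_mono ?_ h
  rintro _ ⟨_, ⟨S, hS, rfl⟩, _, ⟨T, hT, rfl⟩, rfl⟩
  refine ⟨S + T, ⟨?_, ?_⟩, upMon_add S T⟩
  · rw [Multiset.mem_add, not_or]
    exact ⟨hS.1, hT.1⟩
  · rw [Multiset.card_add, hS.2, hT.2]

lemma one_mem_upSpan : (1 : ChowRing M (maxBuildingSet M)) ∈ upSpan M 0 :=
  Submodule.subset_span ⟨0, by simp, upMon_zero⟩

lemma chowGen_mem_upSpan (F : Flat M) : chowGen M F ∈ upSpan M 1 := by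
  by_cases hF : F = ⊥
  · rw [hF, chowGen_bot]
    exact zero_mem _
  induction F using (wellFounded_gt (α := Flat M)).induction with
  | _ F ih =>
  rw [FlatRelations.x_eq (chowGen M) F]
  refine sub_mem (Submodule.subset_span ⟨{F}, ?_, ?_⟩) (sum_mem fun G hG => ?_)
  · simpa [eq_comm] using hF
  · simp [upMon]
  · have hG' : F < G := (Finset.mem_filter.1 hG).2
    exact ih G hG' hG'.ne_bot

lemma monomial_mem_upSpan (d : maxBuildingSet M →₀ ℕ) :
    (Ideal.Quotient.mk (chowIdeal M (maxBuildingSet M)) (MvPolynomial.monomial d 1)) ∈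
      upSpan M d.degree := by
  induction d using Finsupp.induction_linear with
  | zero =>
    rw [map_zero]
    exact one_mem_upSpan (M := M)
  | add d d' h h' =>
    have : (MvPolynomial.monomial (d + d') (1 : ℤ)) =
        MvPolynomial.monomial d 1 * MvPolynomial.monomial d' 1 := by
      rw [MvPolynomial.monomial_mul, one_mul]
    rw [this, map_mul, map_add]
    exact mul_mem_upSpan h h'
  | single G n =>
    rw [← MvPolynomial.X_pow_eq_monomial, map_pow, ← chowGen_buildFlat, Finsupp.degree_single]
    induction n with
    | zero => simpa using one_mem_upSpan (M := M)
    | succ n ih =>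
      rw [pow_succ]
      exact mul_mem_upSpan ih (chowGen_mem_upSpan _)

/-- The x_F and the h_F are related by a triangular linear change of generators, so their monomials
of degree k span the same module. -/
lemma chowPiece_eq_upSpan (M : Matroid α) [M.Finite] (k : ℕ) :
    chowPiece M (maxBuildingSet M) k = upSpan M k := by
  apply le_antisymm
  · rintro _ ⟨p, hp, rfl⟩
    have hp' : p.IsHomogeneous k := hp
    have hsum := p.as_sum
    rw [AlgHom.toLinearMap_apply, Ideal.Quotient.mkₐ_eq_mk, hsum, map_sum]
    refine sum_mem fun d hd => ?_
    have hdeg : d.degree = k := by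
      rw [Finsupp.degree_eq_weight_one]
      exact hp' (MvPolynomial.mem_support_iff.1 hd)
    have : MvPolynomial.monomial d (p.coeff d) = p.coeff d • MvPolynomial.monomial d (1 : ℤ) := by
      rw [MvPolynomial.smul_monomial, smul_eq_mul, mul_one]
    rw [this, map_zsmul, ← hdeg]
    exact Submodule.smul_mem _ _ (monomial_mem_upSpan d)
  · refine Submodule.span_le.2 ?_
    rintro _ ⟨S, ⟨-, rfl⟩, rfl⟩
    rw [SetLike.mem_coe]
    induction S using Multiset.induction_on with
    | empty =>
      exact ⟨1, MvPolynomial.isHomogeneous_one _ _, by simp⟩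
    | cons G S ih =>
      have hG : upSum (chowGen M) G ∈ chowPiece M (maxBuildingSet M) 1 := by
        refine sum_mem fun F _ => ?_
        by_cases hF : F = ⊥
        · rw [hF, chowGen_bot]
          exact zero_mem _
        · obtain ⟨K, rfl⟩ := exists_buildFlat hF
          exact ⟨MvPolynomial.X K, MvPolynomial.isHomogeneous_X _ _, (chowGen_buildFlat K).symm⟩
      obtain ⟨p, hp, hp'⟩ := hG
      obtain ⟨q, hq, hq'⟩ := ih
      refine ⟨p * q, ?_, ?_⟩
      · rw [Multiset.card_cons, add_comm]
        exact MvPolynomial.IsHomogeneous.mul hp hq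
      · rw [upMon_cons, ← hp', ← hq']
        exact map_mul (Ideal.Quotient.mkₐ ℤ (chowIdeal M (maxBuildingSet M))) p q

lemma chowPiece_eq_span_basis (M : Matroid α) [M.Finite] [M.Loopless] (k : ℕ) :
    chowPiece M (maxBuildingSet M) k = Submodule.span ℤ (Set.range
      fun m : {m // m ∈ (basis (Flat.rank : Flat M → ℕ)).filter (fun m => m.card = k)} =>
        upMon (chowGen M) m.1) := by
  have hrange : (Set.range
      fun m : {m // m ∈ (basis (Flat.rank : Flat M → ℕ)).filter (fun m => m.card = k)} =>
        upMon (chowGen M) m.1) =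
      upMon (chowGen M) '' {m | m ∈ basis (Flat.rank : Flat M → ℕ) ∧ m.card = k} := by
    ext u
    simp only [Set.mem_range, Subtype.exists, Finset.mem_filter, Set.mem_image, Set.mem_ofPred_eq,
      exists_prop]
  rw [chowPiece_eq_upSpan, hrange]
  apply le_antisymm
  · refine Submodule.span_le.2 ?_
    rintro _ ⟨S, ⟨hS, rfl⟩, rfl⟩
    exact (flatRelations_chowGen M).upMon_mem_span (Flat.isGeometricRank M) S hS
  · refine Submodule.span_mono (Set.image_mono ?_)
    exact fun m hm => ⟨bot_notMem_of_mem_basis hm.1, hm.2⟩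

/-- The rank of a graded piece of the Chow ring is the number of Feichtner–Yuzvinsky monomials. -/
lemma finrank_chowPiece (M : Matroid α) [M.Finite] [M.Loopless] (k : ℕ) :
    Module.finrank ℤ (chowPiece M (maxBuildingSet M) k) =
      ((basis (Flat.rank : Flat M → ℕ)).filter (fun m => m.card = k)).card := by
  rw [chowPiece_eq_span_basis, finrank_span_eq_card
    ((flatRelations_chowGen M).linearIndependent_upMon (Flat.isGeometricRank M)
      (smul_top_pow_ne_zero M) k), Fintype.card_coe]

lemma coe_basisGen (M : Matroid α) [M.Finite] [M.Loopless] :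
    (basisGen (Flat.rank : Flat M → ℕ) : ℤ⟦X⟧) = chowSeries M (maxBuildingSet M) := by
  ext k
  rw [Polynomial.coeff_coe, chowSeries, PowerSeries.coeff_mk, finrank_chowPiece, basisGen,
    Polynomial.finsetSum_coeff, Finset.card_filter, Nat.cast_sum]
  refine Finset.sum_congr rfl fun S _ => ?_
  rw [Polynomial.coeff_X_pow]
  simp [eq_comm]

end ChowRing

end BuiltMatroid

theorem corollary1p5 {α : Type*} (M : Matroid α) [M.Finite] [M.Loopless] (hr : M.eRank ≤ 6) :
    ∃ H : ℤ[X],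
      (H : ℤ⟦X⟧) = BuiltMatroid.chowSeries M (BuiltMatroid.maxBuildingSet M) ∧
        BuiltMatroid.RealRooted H := by
  refine ⟨_, BuiltMatroid.coe_basisGen M,
    BuiltMatroid.realRooted_basisGen (BuiltMatroid.Flat.isGeometricRank M) ?_⟩
  rw [← Nat.cast_le (α := ℕ∞), BuiltMatroid.Flat.cast_rank, BuiltMatroid.Flat.val_top,
    Matroid.eRk_ground]
  exact hr
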